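/- Let $\mathbb O=\mathbb R^8$ be the octonions with basis $e_0=1,e_1,\dots,e_7$, where $e_i^2=-1$ for $i\ge 1$ and $e_\alpha e_\beta=e_\gamma=-e_\beta e_\alpha$ whenever $(\alpha,\beta,\gamma)$ is a cyclic permutation of one of $(1,2,3),(1,4,5),(1,7,6),(2,4,6),(2,5,7),(3,4,7),(3,6,5)$. A $C^1$ function $f:\Omega\to\mathbb O$ on an open set $\Omega\subseteq\mathbb R^8$ is called left $\mathbb O$-analytic if $Df=\sum_{i=0}^7 e_i\,\partial f/\partial x_i=0$ on $\Omega$. For $k\ge 0$, an inner spherical octonionic-analytic of order $k$ is a left $\mathbb O$-analytic homogeneous polynomial $\mathbb R^8\to\mathbb O$ of degree $k$; an outer spherical octonionic-analytic of order $k$ is a left $\mathbb O$-analytic function on $\mathbb R^8\setminus\{0\}$ that is positively homogeneous of degree $-(k+7)$. On the space $L^2(S^7)$ of square-integrable functions $S^7\to\mathbb O$ on the unit sphere put $$(f,g)_{S^7}=\frac1{\omega_8}\int_{S^7}\bigl(\overline{g(\eta)}\,\overline{\eta}\bigr)\bigl(\eta f(\eta)\bigr)\,dS(\eta),$$ where $dS$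 is the surface area element and $\omega_8$ is the area of $S^7$. Proposition 3.1. Let $f,g\in L^2(S^7)$ have expansions $$f=\sum_{k=0}^\infty(P_kf+Q_kf),\qquad g=\sum_{k=0}^\infty(P_kg+Q_kg)\qquad\text{on } S^7,$$ with partial sums converging in $L^2(S^7)$, where $P_kf,P_kg$ are inner and $Q_kf,Q_kg$ are outer spherical octonionic-analytics of order $k$. Then $$(f,g)_{S^7}=\sum_{k=0}^\infty\bigl((P_kf,P_kg)_{S^7}+(Q_kf,Q_kg)_{S^7}\bigr)+\sum_{k=0}^\infty\bigl((P_kf,Q_{k+1}g)_{S^7}+(Q_{k+1}f,P_kg)_{S^7}\bigr),$$ where both series on the right converge absolutely. The cross terms need not vanish: there are $f,g\in L^2(S^7)$ with such expansions for which $(P_kf,Q_{k+1}g)_{S^7}\ne0$ and $(Q_{k+1}f,P_kg)_{S^7}\ne 0$ for some $k$, and for which the second sum as a whole is not $0$. -/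

import Mathlib

open MeasureTheory Filter Topology

/-- The octonions as a Euclidean space: `x = ∑ i, x i • e i`, with the norm
`|x| = (∑ i, (x i) ^ 2) ^ (1 / 2)`. -/
abbrev Octonion : Type := EuclideanSpace ℝ (Fin 8)

namespace Octonion

/-- The basis `e 0 = 1, e 1, …, e 7`. -/
noncomputable def e (i : Fin 8) : Octonion := EuclideanSpace.single i 1

/-- The triples `(α, β, γ)` with `e α * e β = e γ`, up to cyclic permutation. -/
def triples : List (Fin 8 × Fin 8 × Fin 8) :=
  [(1, 2, 3), (1, 4, 5), (1, 7, 6), (2, 4, 6), (2, 5, 7), (3, 4, 7), (3, 6, 5)]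

/-- `(i, j, k)` is a cyclic permutation of one of the triples. -/
def IsCyclicTriple (i j k : Fin 8) : Prop :=
  (i, j, k) ∈ triples ∨ (j, k, i) ∈ triples ∨ (k, i, j) ∈ triples

instance (i j k : Fin 8) : Decidable (IsCyclicTriple i j k) := by
  unfold IsCyclicTriple; infer_instance

/-- The coefficient of `e k` in the product `e i * e j`. -/
def structConst (i j k : Fin 8) : ℤ :=
  if i = 0 then (if j = k then 1 else 0)
  else if j = 0 then (if i = k then 1 else 0)
  else if i = j then (if k = 0 then -1 else 0)
  else if IsCyclicTriple i j k then 1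
  else if IsCyclicTriple j i k then -1
  else 0

/-- The octonionic product, `x * y = ∑ i, ∑ j, x i y j (e i * e j)`. -/
noncomputable def mul (x y : Octonion) : Octonion :=
  WithLp.toLp 2 fun k => ∑ i, ∑ j, (structConst i j k : ℝ) * (x i * y j)

/-- The conjugate `x 0 - ∑ i ≠ 0, x i • e i`. -/
noncomputable def conj (x : Octonion) : Octonion :=
  WithLp.toLp 2 fun i => if i = 0 then x i else -x i

end Octonion

/-- The octonionic product (left associative as a notation; the product is not associative). -/
infixl:70 " ⊛ " => Octonion.mul

/-- The generalized Cauchy–Riemann operator acting from the left,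
`(D f)(x) = ∑ i, e i * (∂f / ∂x i)(x)`. -/
noncomputable def cauchyRiemann (f : Octonion → Octonion) (x : Octonion) : Octonion :=
  ∑ i, Octonion.e i ⊛ fderiv ℝ f x (Octonion.e i)

/-- `f` is left octonionic analytic in the open set `Ω`: it is `C¹` there and `D f = 0`. -/
def IsLeftAnalyticOn (f : Octonion → Octonion) (Ω : Set Octonion) : Prop :=
  IsOpen Ω ∧ ContDiffOn ℝ 1 f Ω ∧ ∀ x ∈ Ω, cauchyRiemann f x = 0

/-- Inner spherical octonionic-analytics of order `k`: the left octonionic analytic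
(octonion-valued) homogeneous polynomials of degree `k` on `ℝ⁸`. -/
def IsInnerSpherical (k : ℕ) (p : Octonion → Octonion) : Prop :=
  (∃ c : Fin 8 → MvPolynomial (Fin 8) ℝ, (∀ i, (c i).IsHomogeneous k) ∧
    ∀ x i, p x i = MvPolynomial.eval (fun j => x j) (c i)) ∧
  IsLeftAnalyticOn p Set.univ

/-- Outer spherical octonionic-analytics of order `k`: the left octonionic analytic functions
on `ℝ⁸ \ {0}` that are positively homogeneous of degree `-(k + 7)`. -/
def IsOuterSpherical (k : ℕ) (q : Octonion → Octonion) : Prop :=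
  (∀ t : ℝ, 0 < t → ∀ x : Octonion, x ≠ 0 → q (t • x) = t ^ (-((k : ℤ) + 7)) • q x) ∧
  IsLeftAnalyticOn q {0}ᶜ

/-- The unit sphere `S⁷`. -/
abbrev S7 : Type := Metric.sphere (0 : Octonion) 1

/-- The surface area measure `dS` on `S⁷`. -/
noncomputable def areaS7 : Measure S7 := (volume : Measure Octonion).toSphere

/-- The inner product `(f, g) = (1 / ω₈) ∫ (conj g(η) conj η) (η f(η)) dS(η)` over `S⁷`, where
`ω₈` is the surface area of `S⁷`. -/
noncomputable def sphereInner (f g : S7 → Octonion) : Octonion :=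
  (areaS7.real Set.univ)⁻¹ •
    ∫ η : S7, (Octonion.conj (g η) ⊛ Octonion.conj η) ⊛ ((η : Octonion) ⊛ f η) ∂areaS7

/-- The restriction to `S⁷` of a function on `ℝ⁸` (or on `ℝ⁸ \ {0}`). -/
def restrictS7 (p : Octonion → Octonion) : S7 → Octonion := fun η => p η

/-- `f = ∑ k, (P k + Q k)` on `S⁷`, with convergence in `L²(S⁷)`, is an expansion of `f` into
inner (`P k`) and outer (`Q k`) spherical octonionic-analytics of order `k`. -/
structure IsSphericalExpansion (f : S7 → Octonion) (P Q : ℕ → Octonion → Octonion) : Prop where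
  inner : ∀ k, IsInnerSpherical k (P k)
  outer : ∀ k, IsOuterSpherical k (Q k)
  tendsto : Tendsto
    (fun n : ℕ => eLpNorm
      (fun η => f η - ∑ k ∈ Finset.range n, (restrictS7 (P k) η + restrictS7 (Q k) η)) 2 areaS7)
    atTop (𝓝 0)

/-!
For a left analytic `f` both `f` and `x f(x)` have harmonic components: by left alternativity
`Δ f = conj D (D f) = 0`, and `Δ (x f) = x Δ f + 2 D f = 0`. If `f` is homogeneous of degree `d`,
then `x f` is homogeneous of degree `d + 1`. Harmonic functions of degrees `a ≠ b` are orthogonal on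
the sphere unless `a + b = -6`, the case in which they are Kelvin transforms of one another. Since
`conj (η g) (η f)` has components `⟪η f, (η g) u⟫`, which are combinations of products of components
of `η f` and `η g`, the form pairs an inner function of order `k` (where `x f` has degree `k + 1`)
nontrivially only with inner functions of order `k` and with outer ones of order `k + 1` (where
`x f` has degree `-(k + 7)`), and outer functions only with outer ones of the same order and inner
ones of order one less (`IsHomogAnalytic.sphereInner_eq_zero`).

Outer functions are only assumed to be `C¹`, so harmonicity is used in the weak form
`∫ ∇F · ∇ψ = 0` (`IsWeaklyHarmonic`), which follows from `D f = 0` by integration by parts and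
extends from smooth to `C¹` test functions by mollification. Testing `F` with `φ G` and `G` with
`φ F`, for a radial cutoff `φ`, and subtracting gives the orthogonality in polar coordinates
(`IsWeaklyHarmonic.integral_sphere_mul_eq_zero`).

In the real `L²` product all the terms of an expansion are orthogonal: for the pair of orders `k`
and `k + 1` left over above, the degrees `k` and `-(k + 8)` of the functions themselves do the job.
Bessel's inequality then gives the absolute convergence of both series, and continuity of the form
on `L²` identifies their sum (`bilinear_expansion`).

For the cross terms, `Q(x) = |x|⁻¹⁰ conj x L(x)` with `L` linear is outer of order `1` as soon as
`∑ i, conj (e i) L (e i) = 0`. For `L(x) = -x₂ + x₄ e₆` the `e₃` component of `(e₁, Q)` is the mean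
of `x₂² + x₄²`; this is a defect of associativity. As `(g, f) = conj (f, g)`, the choice
`f = e₁ - Q`, `g = e₁ + Q` makes the `e₃` components of the two cross terms add up instead of cancelling.
-/

/-! ### The algebra of the octonions -/

namespace Octonion

theorem mul_apply (x y : Octonion) (k : Fin 8) :
    (x ⊛ y) k = ∑ i, ∑ j, (structConst i j k : ℝ) * (x i * y j) := rfl

theorem conj_apply (x : Octonion) (i : Fin 8) : conj x i = if i = 0 then x i else -x i := rfl

/-- The multiplication table, written out coordinate by coordinate. -/
theorem mul_coords (x y : Octonion) :
    (x ⊛ y) 0 = x 0 * y 0 - x 1 * y 1 - x 2 * y 2 - x 3 * y 3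
      - x 4 * y 4 - x 5 * y 5 - x 6 * y 6 - x 7 * y 7 ∧
    (x ⊛ y) 1 = x 0 * y 1 + x 1 * y 0 + x 2 * y 3 - x 3 * y 2
      + x 4 * y 5 - x 5 * y 4 - x 6 * y 7 + x 7 * y 6 ∧
    (x ⊛ y) 2 = x 0 * y 2 - x 1 * y 3 + x 2 * y 0 + x 3 * y 1
      + x 4 * y 6 + x 5 * y 7 - x 6 * y 4 - x 7 * y 5 ∧
    (x ⊛ y) 3 = x 0 * y 3 + x 1 * y 2 - x 2 * y 1 + x 3 * y 0
      + x 4 * y 7 - x 5 * y 6 + x 6 * y 5 - x 7 * y 4 ∧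
    (x ⊛ y) 4 = x 0 * y 4 - x 1 * y 5 - x 2 * y 6 - x 3 * y 7
      + x 4 * y 0 + x 5 * y 1 + x 6 * y 2 + x 7 * y 3 ∧
    (x ⊛ y) 5 = x 0 * y 5 + x 1 * y 4 - x 2 * y 7 + x 3 * y 6
      - x 4 * y 1 + x 5 * y 0 - x 6 * y 3 + x 7 * y 2 ∧
    (x ⊛ y) 6 = x 0 * y 6 + x 1 * y 7 + x 2 * y 4 - x 3 * y 5
      - x 4 * y 2 + x 5 * y 3 + x 6 * y 0 - x 7 * y 1 ∧
    (x ⊛ y) 7 = x 0 * y 7 - x 1 * y 6 + x 2 * y 5 + x 3 * y 4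
      - x 4 * y 3 - x 5 * y 2 + x 6 * y 1 + x 7 * y 0 := by
  refine ⟨?_, ?_, ?_, ?_, ?_, ?_, ?_, ?_⟩ <;>
  · rw [mul_apply]
    simp [Fin.sum_univ_eight, structConst, IsCyclicTriple, triples]
    ring

protected theorem mul_add (x y z : Octonion) : x ⊛ (y + z) = x ⊛ y + x ⊛ z := by
  ext k
  simp [mul_apply, mul_add, Finset.sum_add_distrib]

protected theorem add_mul (x y z : Octonion) : (x + y) ⊛ z = x ⊛ z + y ⊛ z := by
  ext k
  simp [mul_apply, mul_add, add_mul, Finset.sum_add_distrib]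

protected theorem mul_smul (c : ℝ) (x y : Octonion) : x ⊛ (c • y) = c • (x ⊛ y) := by
  ext k
  simp only [mul_apply, PiLp.smul_apply, smul_eq_mul, Finset.mul_sum]
  exact Finset.sum_congr rfl fun i _ => Finset.sum_congr rfl fun j _ => by ring

theorem smul_mul (c : ℝ) (x y : Octonion) : (c • x) ⊛ y = c • (x ⊛ y) := by
  ext k
  simp only [mul_apply, PiLp.smul_apply, smul_eq_mul, Finset.mul_sum]
  exact Finset.sum_congr rfl fun i _ => Finset.sum_congr rfl fun j _ => by ring

theorem conj_conj (x : Octonion) : conj (conj x) = x := by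
  ext i
  by_cases h : i = 0 <;> simp [conj_apply, h]

theorem norm_conj (x : Octonion) : ‖conj x‖ = ‖x‖ := by
  simp only [EuclideanSpace.norm_eq, Fin.sum_univ_eight]
  simp [conj_apply]

/-- Left multiplication by `conj x` is the adjoint of left multiplication by `x`. -/
theorem inner_mul_left (x y z : Octonion) :
    inner ℝ (x ⊛ y) z = inner ℝ y (conj x ⊛ z) := by
  obtain ⟨h0, h1, h2, h3, h4, h5, h6, h7⟩ := mul_coords x y
  obtain ⟨k0, k1, k2, k3, k4, k5, k6, k7⟩ := mul_coords (conj x) z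
  simp only [PiLp.inner_apply, Fin.sum_univ_eight, h0, h1, h2, h3, h4, h5, h6, h7,
    k0, k1, k2, k3, k4, k5, k6, k7]
  simp [conj_apply]
  ring

theorem conj_mul (x y : Octonion) : conj (x ⊛ y) = conj y ⊛ conj x := by
  obtain ⟨h0, h1, h2, h3, h4, h5, h6, h7⟩ := mul_coords x y
  obtain ⟨k0, k1, k2, k3, k4, k5, k6, k7⟩ := mul_coords (conj y) (conj x)
  ext i
  fin_cases i <;>
  · simp [conj_apply, h0, h1, h2, h3, h4, h5, h6, h7, k0, k1, k2, k3, k4, k5, k6, k7]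
    ring

/-- Left alternativity, in the form `conj x (x y) = |x|² y`. -/
theorem conj_mul_mul (x y : Octonion) : conj x ⊛ (x ⊛ y) = ‖x‖ ^ 2 • y := by
  obtain ⟨h0, h1, h2, h3, h4, h5, h6, h7⟩ := mul_coords x y
  obtain ⟨k0, k1, k2, k3, k4, k5, k6, k7⟩ := mul_coords (conj x) (x ⊛ y)
  have hn : ‖x‖ ^ 2 = x 0 ^ 2 + x 1 ^ 2 + x 2 ^ 2 + x 3 ^ 2 + x 4 ^ 2 + x 5 ^ 2 + x 6 ^ 2
      + x 7 ^ 2 := by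
    simp [EuclideanSpace.norm_sq_eq, Fin.sum_univ_eight]
  ext i
  fin_cases i <;>
  · simp only [PiLp.smul_apply, smul_eq_mul, hn, Fin.reduceFinMk, Fin.zero_eta, Fin.mk_one,
      k0, k1, k2, k3, k4, k5, k6, k7, h0, h1, h2, h3, h4, h5, h6, h7]
    simp [conj_apply]
    ring

theorem mul_conj_mul (x y : Octonion) : x ⊛ (conj x ⊛ y) = ‖x‖ ^ 2 • y := by
  simpa [conj_conj, norm_conj] using conj_mul_mul (conj x) y

/-- The norm is multiplicative. -/
protected theorem norm_mul (x y : Octonion) : ‖x ⊛ y‖ = ‖x‖ * ‖y‖ := by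
  have h : ‖x ⊛ y‖ ^ 2 = (‖x‖ * ‖y‖) ^ 2 := by
    rw [← real_inner_self_eq_norm_sq, inner_mul_left, conj_mul_mul, real_inner_smul_right,
      real_inner_self_eq_norm_sq, mul_pow]
  exact (pow_left_inj₀ (norm_nonneg _) (by positivity) two_ne_zero).1 h

/-- The octonionic product as a continuous bilinear map. -/
noncomputable def mulL : Octonion →L[ℝ] Octonion →L[ℝ] Octonion :=
  LinearMap.mkContinuous₂ (LinearMap.mk₂ ℝ mul Octonion.add_mul smul_mul Octonion.mul_add
    Octonion.mul_smul) 1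
    fun x y => by simp [Octonion.norm_mul]

theorem mulL_apply (x y : Octonion) : mulL x y = x ⊛ y := rfl

/-- Conjugation as a continuous linear map. -/
noncomputable def conjL : Octonion →L[ℝ] Octonion :=
  LinearMap.mkContinuous
    { toFun := conj
      map_add' := fun x y => by
        ext i
        by_cases h : i = 0 <;> simp [conj_apply, h, add_comm]
      map_smul' := fun c x => by
        ext i
        by_cases h : i = 0 <;> simp [conj_apply, h] } 1
    fun x => by simp [norm_conj]

theorem conj_add (x y : Octonion) : conj (x + y) = conj x + conj y := conjL.map_add x y

protected theorem mul_sub (x y z : Octonion) : x ⊛ (y - z) = x ⊛ y - x ⊛ z := (mulL x).map_sub y z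

protected theorem mul_zero (x : Octonion) : x ⊛ 0 = 0 := (mulL x).map_zero

theorem mul_sum {ι : Type*} (s : Finset ι) (x : Octonion) (y : ι → Octonion) :
    x ⊛ (∑ i ∈ s, y i) = ∑ i ∈ s, x ⊛ y i := map_sum (mulL x) y s

/-- Polarised left alternativity. -/
theorem conj_mul_mul_add (x y z : Octonion) :
    conj x ⊛ (y ⊛ z) + conj y ⊛ (x ⊛ z) = (2 * inner ℝ x y : ℝ) • z := by
  have h := conj_mul_mul (x + y) z
  have hn := norm_add_sq_real x y
  rw [hn, conj_add, Octonion.add_mul x y z, Octonion.add_mul (conj x), Octonion.mul_add,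
    Octonion.mul_add, conj_mul_mul,
    conj_mul_mul, add_smul, add_smul] at h
  rw [← sub_eq_zero] at h ⊢
  rw [← h]
  abel

theorem mul_conj_mul_add (x y z : Octonion) :
    x ⊛ (conj y ⊛ z) + y ⊛ (conj x ⊛ z) = (2 * inner ℝ x y : ℝ) • z := by
  have h := conj_mul_mul_add (conj x) (conj y) z
  have hi : inner ℝ (conj x) (conj y) = inner ℝ x y := by
    simp only [PiLp.inner_apply, Fin.sum_univ_eight]
    simp [conj_apply]
  rwa [conj_conj, conj_conj, hi] at h

theorem inner_conj_mul (a b u : Octonion) :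
    inner ℝ (conj b ⊛ a) u = inner ℝ a (b ⊛ u) := by
  rw [inner_mul_left, conj_conj]

theorem e_apply (i j : Fin 8) : e i j = if j = i then 1 else 0 := by
  simp [e]

theorem inner_e_right (x : Octonion) (i : Fin 8) : inner ℝ x (e i) = x i := by
  simp [e, EuclideanSpace.inner_single_right]

theorem inner_e_left (x : Octonion) (i : Fin 8) : inner ℝ (e i) x = x i := by
  simp [e, EuclideanSpace.inner_single_left]

theorem norm_e (i : Fin 8) : ‖e i‖ = 1 := by
  simp [e]

theorem sum_smul_e (x : Octonion) : ∑ i, x i • e i = x := by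
  ext j
  simp [e_apply]

theorem mul_e_zero (x : Octonion) : x ⊛ e 0 = x := by
  obtain ⟨h0, h1, h2, h3, h4, h5, h6, h7⟩ := mul_coords x (e 0)
  ext i
  fin_cases i <;> simp [h0, h1, h2, h3, h4, h5, h6, h7, e_apply]

end Octonion

/-! ### Integration by parts away from the origin -/

open scoped ContDiff

/-- Compactly supported functions that vanish near the origin. -/
def IsTestAwayZero {F : Type*} [Zero F] (φ : Octonion → F) : Prop :=
  HasCompactSupport φ ∧ (0 : Octonion) ∉ tsupport φ

namespace IsTestAwayZero

theorem of_zero {F G : Type*} [Zero F] [Zero G] {φ : Octonion → F} {h : Octonion → G}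
    (hφ : IsTestAwayZero φ) (hz : ∀ x, φ x = 0 → h x = 0) : IsTestAwayZero h := by
  have hs : Function.support h ⊆ Function.support φ := fun x hx hx' => hx (hz x hx')
  exact ⟨hφ.1.mono hs, fun h0 => hφ.2 (closure_mono hs h0)⟩

theorem fderiv {F : Type*} [NormedAddCommGroup F] [NormedSpace ℝ F]
    {φ : Octonion → F} (hφ : IsTestAwayZero φ) :
    IsTestAwayZero (_root_.fderiv ℝ φ) :=
  ⟨hφ.1.fderiv ℝ, fun h0 => hφ.2 (tsupport_fderiv_subset ℝ h0)⟩

theorem fderiv_apply {F : Type*} [NormedAddCommGroup F] [NormedSpace ℝ F]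
    {φ : Octonion → F} (hφ : IsTestAwayZero φ) (v : Octonion) :
    IsTestAwayZero (fun x => _root_.fderiv ℝ φ x v) :=
  hφ.fderiv.of_zero fun x hx => by simp [hx]

theorem add {F : Type*} [NormedAddCommGroup F]
    {φ ψ : Octonion → F} (hφ : IsTestAwayZero φ) (hψ : IsTestAwayZero ψ) :
    IsTestAwayZero (fun x => φ x + ψ x) := by
  refine ⟨hφ.1.add hψ.1, fun h0 => ?_⟩
  rcases tsupport_add φ ψ h0 with h | h
  exacts [hφ.2 h, hψ.2 h]

theorem ne_zero_of_mem {F : Type*} [NormedAddCommGroup F]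
    {φ : Octonion → F} (hφ : IsTestAwayZero φ) {x : Octonion}
    (hx : x ∈ tsupport φ) : x ∈ ({0}ᶜ : Set Octonion) := by
  rintro rfl
  exact hφ.2 hx

theorem continuous {F : Type*} [NormedAddCommGroup F]
    {φ : Octonion → F} (hφ : IsTestAwayZero φ)
    (hc : ContinuousOn φ {0}ᶜ) : Continuous φ :=
  continuous_of_tsupport fun _ hx =>
    hc.continuousAt (isOpen_compl_singleton.mem_nhds (hφ.ne_zero_of_mem hx))

theorem integrable {F : Type*} [NormedAddCommGroup F] [NormedSpace ℝ F]
    {φ : Octonion → F} (hφ : IsTestAwayZero φ)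
    (hc : ContinuousOn φ {0}ᶜ) : Integrable φ :=
  (hφ.continuous hc).integrable_of_hasCompactSupport hφ.1

end IsTestAwayZero

theorem continuousOn_fderiv_apply {F : Type*} [NormedAddCommGroup F] [NormedSpace ℝ F]
    {f : Octonion → F} (hf : ContDiffOn ℝ 1 f {0}ᶜ) (v : Octonion) :
    ContinuousOn (fun x => fderiv ℝ f x v) {0}ᶜ :=
  (hf.continuousOn_fderiv_of_isOpen isOpen_compl_singleton le_rfl).clm_apply continuousOn_const

theorem differentiableAt_of_ne {F : Type*} [NormedAddCommGroup F] [NormedSpace ℝ F]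
    {f : Octonion → F} (hf : ContDiffOn ℝ 1 f {0}ᶜ) {x : Octonion}
    (hx : x ∈ ({0}ᶜ : Set Octonion)) :
    DifferentiableAt ℝ f x :=
  (hf.contDiffAt (isOpen_compl_singleton.mem_nhds hx)).differentiableAt one_ne_zero

theorem integral_inner_fderiv_left {F : Type*} [NormedAddCommGroup F] [InnerProductSpace ℝ F]
    {f φ : Octonion → F} (hf : ContDiffOn ℝ 1 f {0}ᶜ) (hφ : ContDiff ℝ 1 φ)
    (ht : IsTestAwayZero φ) (v : Octonion) :
    ∫ x, inner ℝ (fderiv ℝ f x v) (φ x) = -∫ x, inner ℝ (f x) (fderiv ℝ φ x v) := by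
  have hf' := continuousOn_fderiv_apply hf v
  have hφ' : Continuous fun x => fderiv ℝ φ x v :=
    (hφ.continuous_fderiv one_ne_zero).clm_apply continuous_const
  have key : ∫ x, inner ℝ (f x) (fderiv ℝ φ x v) = -∫ x, inner ℝ (fderiv ℝ f x v) (φ x) :=
    integral_bilinear_fderiv_right_eq_neg_left_of_integrable (B := innerSL ℝ)
      ((ht.of_zero fun x hx => by simp [hx]).integrable (hf'.inner hφ.continuous.continuousOn))
      (((ht.fderiv_apply v).of_zero fun x hx => by simp [hx]).integrable
        (hf.continuousOn.inner hφ'.continuousOn))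
      ((ht.of_zero fun x hx => by simp [hx]).integrable
        (hf.continuousOn.inner hφ.continuous.continuousOn))
      (fun x hx => differentiableAt_of_ne hf (ht.ne_zero_of_mem hx))
      (fun x _ => (hφ.differentiable one_ne_zero) x)
  rw [key, neg_neg]

/-! ### Weak harmonicity of analytic functions -/

open Octonion

/-- A scalar function is weakly harmonic away from the origin if it is `C¹` there and its gradient
is orthogonal to the gradients of all smooth test functions. Analytic functions are only assumed
to be `C¹`, so that this weak form is what the equation `D f = 0` gives without any regularity
theory. -/
def IsWeaklyHarmonic (F : Octonion → ℝ) : Prop :=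
  ContDiffOn ℝ 1 F {0}ᶜ ∧ ∀ ψ : Octonion → ℝ, ContDiff ℝ ∞ ψ → IsTestAwayZero ψ →
    ∫ x, ∑ i, fderiv ℝ F x (e i) * fderiv ℝ ψ x (e i) = 0

/-- The weak form of `D f = 0`: the adjoint of `D` is `-∑ i, conj (e i) ∂ᵢ`. -/
theorem integral_inner_conj_cauchyRiemann {f χ : Octonion → Octonion}
    (hf : IsLeftAnalyticOn f {0}ᶜ) (hχ : ContDiff ℝ 1 χ) (ht : IsTestAwayZero χ) :
    ∫ x, inner ℝ (f x) (∑ i, conj (e i) ⊛ fderiv ℝ χ x (e i)) = 0 := by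
  obtain ⟨-, hf1, hD⟩ := hf
  have hconst : ∀ i, ContDiff ℝ 1 fun x => conj (e i) ⊛ χ x := fun i =>
    (mulL (conj (e i))).contDiff.comp hχ
  have htest : ∀ i, IsTestAwayZero fun x => conj (e i) ⊛ χ x := fun i =>
    ht.of_zero fun x hx => by rw [hx, Octonion.mul_zero]
  have hd : ∀ i x, fderiv ℝ (fun x => conj (e i) ⊛ χ x) x (e i)
      = conj (e i) ⊛ fderiv ℝ χ x (e i) := fun i x => by
    have := ((mulL (conj (e i))).hasFDerivAt.comp x
      ((hχ.differentiable one_ne_zero) x).hasFDerivAt).fderiv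
    exact congrArg (fun l : Octonion →L[ℝ] Octonion => l (e i)) this
  have hint1 : ∀ i, Integrable fun x => inner ℝ (fderiv ℝ f x (e i)) (conj (e i) ⊛ χ x) :=
    fun i => ((htest i).of_zero fun x hx => by simp [hx]).integrable
      ((continuousOn_fderiv_apply hf1 _).inner (hconst i).continuous.continuousOn)
  have hint2 : ∀ i, Integrable fun x =>
      inner ℝ (f x) (fderiv ℝ (fun x => conj (e i) ⊛ χ x) x (e i)) :=
    fun i => (((htest i).fderiv_apply (e i)).of_zero fun x hx => by simp [hx]).integrable
      (hf1.continuousOn.inner (((hconst i).continuous_fderiv one_ne_zero).clm_apply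
        continuous_const).continuousOn)
  have h0 : ∫ x, ∑ i, inner ℝ (fderiv ℝ f x (e i)) (conj (e i) ⊛ χ x) = 0 := by
    rw [integral_eq_zero_of_ae]
    refine Eventually.of_forall fun x => ?_
    by_cases hx : x = 0
    · have : χ x = 0 := by
        subst hx
        exact image_eq_zero_of_notMem_tsupport ht.2
      simp [this, Octonion.mul_zero]
    · have := hD x hx
      simp only [← inner_mul_left, ← sum_inner]
      rw [cauchyRiemann] at this
      simp [this]
  rw [integral_finsetSum _ fun i _ => hint1 i] at h0
  simp only [integral_inner_fderiv_left hf1 (hconst _) (htest _)] at h0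
  rw [Finset.sum_neg_distrib, neg_eq_zero, ← integral_finsetSum _ fun i _ => hint2 i] at h0
  simpa only [hd, inner_sum] using h0

/-- If `(Δ ψ) m` lies in the image of the adjoint of `D` for all test functions `ψ`, then `⟪f, m⟫`
is weakly harmonic for every analytic `f`. -/
theorem isWeaklyHarmonic_inner {f m : Octonion → Octonion} (hf : IsLeftAnalyticOn f {0}ᶜ)
    (hm : ContDiff ℝ 1 m)
    (h : ∀ ψ : Octonion → ℝ, ContDiff ℝ ∞ ψ → IsTestAwayZero ψ →
      ∃ χ : Octonion → Octonion, ContDiff ℝ 1 χ ∧ IsTestAwayZero χ ∧ ∀ x,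
        ∑ i, conj (e i) ⊛ fderiv ℝ χ x (e i)
          = (∑ i, fderiv ℝ (fun y => fderiv ℝ ψ y (e i)) x (e i)) • m x) :
    IsWeaklyHarmonic fun x => inner ℝ (f x) (m x) := by
  have hF : ContDiffOn ℝ 1 (fun x => inner ℝ (f x) (m x)) {0}ᶜ := hf.2.1.inner ℝ hm.contDiffOn
  refine ⟨hF, fun ψ hψ ht => ?_⟩
  obtain ⟨χ, hχ, hχt, hχe⟩ := h ψ hψ ht
  have hψ1 : ∀ i, ContDiff ℝ 1 fun y => fderiv ℝ ψ y (e i) := fun i =>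
    ((contDiff_infty.1 hψ 2).fderiv_right (m := 1) (by norm_num)).clm_apply contDiff_const
  have hψ2 : ∀ i, Continuous fun x => fderiv ℝ (fun y => fderiv ℝ ψ y (e i)) x (e i) := fun i =>
    ((hψ1 i).continuous_fderiv one_ne_zero).clm_apply continuous_const
  have hibp : ∀ i, ∫ x, fderiv ℝ (fun x => inner ℝ (f x) (m x)) x (e i) * fderiv ℝ ψ x (e i)
      = -∫ x, inner ℝ (f x) (m x) * fderiv ℝ (fun y => fderiv ℝ ψ y (e i)) x (e i) := fun i => by
    have := integral_inner_fderiv_left hF (hψ1 i) (ht.fderiv_apply (e i)) (e i)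
    simpa [mul_comm] using this
  rw [integral_finsetSum]
  · simp only [hibp]
    rw [Finset.sum_neg_distrib, ← integral_finsetSum]
    · have := integral_inner_conj_cauchyRiemann hf hχ hχt
      simp only [hχe, real_inner_smul_right, Finset.sum_mul] at this
      simpa [mul_comm] using this
    · intro i _
      exact (((ht.fderiv_apply (e i)).fderiv_apply (e i)).of_zero fun x hx => by
        simp [hx]).integrable (hF.continuousOn.mul (hψ2 i).continuousOn)
  · intro i _
    exact ((ht.fderiv_apply (e i)).of_zero fun x hx => by simp [hx]).integrable
      ((continuousOn_fderiv_apply hF _).mul (hψ1 i).continuous.continuousOn)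

theorem fderiv_fderiv_comm {ψ : Octonion → ℝ} (hψ : ContDiff ℝ ∞ ψ) (x v w : Octonion) :
    fderiv ℝ (fun y => fderiv ℝ ψ y v) x w = fderiv ℝ (fun y => fderiv ℝ ψ y w) x v := by
  have hd : DifferentiableAt ℝ (fderiv ℝ ψ) x :=
    ((contDiff_infty.1 hψ 2).fderiv_right (m := 1) (by norm_num)).differentiable one_ne_zero x
  have hs : IsSymmSndFDerivAt ℝ ψ x :=
    (contDiff_infty.1 hψ 2).contDiffAt.isSymmSndFDerivAt (by simp)
  rw [fderiv_clm_apply hd (differentiableAt_const v),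
    fderiv_clm_apply hd (differentiableAt_const w)]
  simpa using hs w v

/-- Symmetric sums contract `conj (e j) (e i ·)` to the trace. -/
theorem sum_symm_conj_mul (s : Fin 8 → Fin 8 → ℝ) (hs : ∀ i j, s i j = s j i) (v : Octonion) :
    ∑ j, ∑ i, s i j • (conj (e j) ⊛ (e i ⊛ v)) = (∑ i, s i i) • v := by
  have h2 : (2 : ℝ) • ∑ j, ∑ i, s i j • (conj (e j) ⊛ (e i ⊛ v))
      = (2 : ℝ) • ((∑ i, s i i) • v) := by
    calc (2 : ℝ) • ∑ j, ∑ i, s i j • (conj (e j) ⊛ (e i ⊛ v))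
        = ∑ j, ∑ i, s i j • (conj (e j) ⊛ (e i ⊛ v))
          + ∑ j, ∑ i, s i j • (conj (e i) ⊛ (e j ⊛ v)) := by
          rw [two_smul]
          congr 1
          rw [Finset.sum_comm]
          simp only [hs]
      _ = ∑ j, ∑ i, s i j • ((2 * inner ℝ (e j) (e i) : ℝ) • v) := by
          simp only [← Finset.sum_add_distrib, ← smul_add, conj_mul_mul_add]
      _ = _ := by
          simp only [inner_e_left, e_apply, smul_smul, ← Finset.sum_smul]
          congr 1
          simp [Finset.mul_sum, mul_comm]
  exact smul_right_injective _ two_ne_zero h2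

theorem sum_conj_mul_mul_conj (i : Fin 8) (v : Octonion) :
    ∑ j, conj (e j) ⊛ (e i ⊛ (conj (e j) ⊛ v)) = (-6 : ℝ) • (conj (e i) ⊛ v) := by
  have h : ∀ j, conj (e j) ⊛ (e i ⊛ (conj (e j) ⊛ v))
      = (2 * inner ℝ (e j) (e i) : ℝ) • (conj (e j) ⊛ v) - conj (e i) ⊛ v := fun j => by
    rw [eq_sub_iff_add_eq, ← conj_mul_mul_add (e j) (e i), mul_conj_mul, norm_e]
    simp
  simp only [h, Finset.sum_sub_distrib, inner_e_left, e_apply]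
  simp [ite_smul, mul_ite]
  module

theorem contDiff_fderiv_apply {ψ : Octonion → ℝ} (hψ : ContDiff ℝ ∞ ψ) (v : Octonion) :
    ContDiff ℝ 1 fun y => fderiv ℝ ψ y v :=
  ((contDiff_infty.1 hψ 2).fderiv_right (m := 1) (by norm_num)).clm_apply contDiff_const

theorem fderiv_smul_apply {c : Octonion → ℝ} {h : Octonion → Octonion} {x : Octonion}
    (hc : DifferentiableAt ℝ c x) (hh : DifferentiableAt ℝ h x) (v : Octonion) :
    fderiv ℝ (fun y => c y • h y) x v = c x • fderiv ℝ h x v + fderiv ℝ c x v • h x := by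
  rw [fderiv_fun_smul hc hh]
  simp

/-- The components of an analytic function are weakly harmonic. -/
theorem isWeaklyHarmonic_inner_const {f : Octonion → Octonion} (hf : IsLeftAnalyticOn f {0}ᶜ)
    (w : Octonion) : IsWeaklyHarmonic fun x => inner ℝ (f x) w := by
  refine isWeaklyHarmonic_inner hf contDiff_const fun ψ hψ ht => ?_
  have h1 := contDiff_fderiv_apply hψ
  have hb : ∀ i, ContDiff ℝ 1 fun x => fderiv ℝ ψ x (e i) • (e i ⊛ w) := fun i =>
    (h1 _).smul contDiff_const
  refine ⟨fun x => ∑ i, fderiv ℝ ψ x (e i) • (e i ⊛ w), ?_, ?_, fun x => ?_⟩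
  · exact ContDiff.sum fun i _ => hb i
  · exact ht.fderiv.of_zero fun x hx => by simp [hx]
  · rw [← sum_symm_conj_mul (fun i j => fderiv ℝ (fun y => fderiv ℝ ψ y (e i)) x (e j))
      (fun i j => fderiv_fderiv_comm hψ x _ _)]
    refine Finset.sum_congr rfl fun j _ => ?_
    rw [fderiv_fun_sum fun i _ => (hb i).differentiable one_ne_zero x, sum_apply, mul_sum]
    refine Finset.sum_congr rfl fun i _ => ?_
    rw [fderiv_smul_apply ((h1 _).differentiable one_ne_zero x) (differentiableAt_const _)]
    simp [Octonion.mul_smul]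

/-- The components of `x f(x)` are weakly harmonic for analytic `f`. The underlying identity is
`Δ (x f) = x Δ f + 2 D f`. -/
theorem isWeaklyHarmonic_inner_mul {f : Octonion → Octonion} (hf : IsLeftAnalyticOn f {0}ᶜ)
    (w : Octonion) : IsWeaklyHarmonic fun x => inner ℝ (x ⊛ f x) w := by
  set A : Fin 8 → Octonion →L[ℝ] Octonion := fun i =>
    (mulL (e i)).comp ((mulL.flip w).comp conjL) with hA
  have hAx : ∀ i x, A i x = e i ⊛ (conj x ⊛ w) := fun i x => rfl
  have hm : ContDiff ℝ 1 fun x => conj x ⊛ w := ((mulL.flip w).comp conjL).contDiff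
  simp only [inner_mul_left]
  refine isWeaklyHarmonic_inner hf hm fun ψ hψ ht => ?_
  have h1 := contDiff_fderiv_apply hψ
  have h0 : ContDiff ℝ 1 ψ := contDiff_infty.1 hψ 1
  have ha : ContDiff ℝ 1 fun x => ψ x • ((6 : ℝ) • w) := h0.smul contDiff_const
  have hb : ∀ i, ContDiff ℝ 1 fun x => fderiv ℝ ψ x (e i) • A i x := fun i =>
    (h1 _).smul (A i).contDiff
  -- The potential is `D h - 2 ψ w` with `h = conj x (ψ w)`: `Δ h - conj x Δ (ψ w)` is twice the
  -- conjugate of `D` applied to `ψ w`.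
  refine ⟨fun x => ψ x • ((6 : ℝ) • w) + ∑ i, fderiv ℝ ψ x (e i) • A i x, ?_, ?_, fun x => ?_⟩
  · exact ha.add (ContDiff.sum fun i _ => hb i)
  · exact (ht.of_zero fun x hx => by simp [hx]).add (ht.fderiv.of_zero fun x hx => by simp [hx])
  · have hd : ∀ j, fderiv ℝ (fun x => ψ x • ((6 : ℝ) • w) + ∑ i, fderiv ℝ ψ x (e i) • A i x) x (e j)
        = fderiv ℝ ψ x (e j) • ((6 : ℝ) • w) + ∑ i, (fderiv ℝ ψ x (e i) • A i (e j)
          + fderiv ℝ (fun y => fderiv ℝ ψ y (e i)) x (e j) • A i x) := fun j => by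
      rw [fderiv_fun_add (ha.differentiable one_ne_zero x)
        ((ContDiff.sum fun i _ => hb i).differentiable one_ne_zero x),
        fderiv_fun_sum fun i _ => (hb i).differentiable one_ne_zero x]
      rw [add_apply, sum_apply,
        fderiv_smul_apply (h0.differentiable one_ne_zero x) (differentiableAt_const _)]
      congr 1
      · simp
      · refine Finset.sum_congr rfl fun i _ => ?_
        rw [fderiv_smul_apply ((h1 _).differentiable one_ne_zero x) (A i).differentiableAt,
          ContinuousLinearMap.fderiv]
    simp only [hd]
    simp only [hAx, Octonion.mul_add, mul_sum, Octonion.mul_smul, Finset.sum_add_distrib]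
    rw [← sum_symm_conj_mul (fun i j => fderiv ℝ (fun y => fderiv ℝ ψ y (e i)) x (e j))
      (fun i j => fderiv_fderiv_comm hψ x _ _), ← add_assoc, add_eq_right]
    rw [Finset.sum_comm (γ := Fin 8), ← Finset.sum_add_distrib]
    refine Finset.sum_eq_zero fun i _ => ?_
    rw [← Finset.smul_sum, sum_conj_mul_mul_conj]
    module

/-! ### Test functions of class `C¹` -/

/-- Mollification: a `C¹` test function is approximated, in the `C¹` norm and with supports in a
fixed compact set, by smooth test functions. -/
theorem IsTestAwayZero.exists_smooth_approx {ψ : Octonion → ℝ} (hψ : ContDiff ℝ 1 ψ)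
    (ht : IsTestAwayZero ψ) :
    ∃ K : Set Octonion, IsCompact K ∧ (0 : Octonion) ∉ K ∧ tsupport ψ ⊆ K ∧
      ∀ ε : ℝ, 0 < ε → ∃ η : Octonion → ℝ, ContDiff ℝ ∞ η ∧ IsTestAwayZero η ∧ tsupport η ⊆ K ∧
        ∀ x i, |_root_.fderiv ℝ η x (e i) - _root_.fderiv ℝ ψ x (e i)| ≤ ε := by
  have hcpt : IsCompact (tsupport ψ) := ht.1
  obtain ⟨δ, hδ, hδK⟩ : ∃ δ : ℝ, 0 < δ ∧ Metric.cthickening δ (tsupport ψ) ⊆ {0}ᶜ :=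
    hcpt.exists_cthickening_subset_open isOpen_compl_singleton fun x hx => ht.ne_zero_of_mem hx
  refine ⟨Metric.cthickening δ (tsupport ψ), hcpt.cthickening, fun h => hδK h rfl,
    Metric.self_subset_cthickening _, fun ε hε => ?_⟩
  have hcd : Continuous (_root_.fderiv ℝ ψ) := hψ.continuous_fderiv one_ne_zero
  have huc : UniformContinuous (_root_.fderiv ℝ ψ) := 
    (ht.1.fderiv ℝ).uniformContinuous_of_continuous hcd
  obtain ⟨r, hr, hrε⟩ := Metric.uniformContinuous_iff.1 huc ε hε
  have hpos : 0 < min r δ := lt_min hr hδ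
  let b : ContDiffBump (0 : Octonion) := ⟨min r δ / 2, min r δ, by positivity, by linarith⟩
  have hb : b.rOut = min r δ := rfl
  have hsub : tsupport (convolution (b.normed volume) ψ (ContinuousLinearMap.lsmul ℝ ℝ) volume)
      ⊆ Metric.cthickening δ (tsupport ψ) := by
    refine closure_minimal ?_ Metric.isClosed_cthickening
    refine (support_convolution_subset _).trans ?_
    rintro _ ⟨y, hy, z, hz, rfl⟩
    rw [b.support_normed_eq, mem_ball_zero_iff, hb] at hy
    refine Metric.mem_cthickening_of_dist_le _ z _ _ (subset_closure hz) ?_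
    rw [dist_eq_norm]
    simpa using (hy.le.trans (min_le_right r δ))
  refine ⟨convolution (b.normed volume) ψ (ContinuousLinearMap.lsmul ℝ ℝ) volume, ?_, ?_, ?_, ?_⟩
  · exact b.hasCompactSupport_normed.contDiff_convolution_left _ b.contDiff_normed
      hψ.continuous.locallyIntegrable
  · exact ⟨b.hasCompactSupport_normed.convolution _ ht.1, fun h => hδK (hsub h) rfl⟩
  · exact hsub
  · intro x i
    have hfd := (HasCompactSupport.hasFDerivAt_convolution_right
      (L := ContinuousLinearMap.lsmul ℝ ℝ) (μ := (volume : Measure Octonion))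
      (f := b.normed volume) ht.1
      (b.continuous_normed).locallyIntegrable hψ x).fderiv
    rw [hfd, convolution_precompR_apply _ b.continuous_normed.locallyIntegrable
      (ht.1.fderiv ℝ) hcd]
    refine b.dist_normed_convolution_le (g := fun a => _root_.fderiv ℝ ψ a (e i))
      (hcd.clm_apply continuous_const).aestronglyMeasurable fun y hy => ?_
    have h1 := hrε (a := y) (b := x) (lt_of_lt_of_le hy (min_le_left r δ))
    rw [dist_eq_norm] at h1
    calc dist (_root_.fderiv ℝ ψ y (e i)) (_root_.fderiv ℝ ψ x (e i))
        = ‖(_root_.fderiv ℝ ψ y - _root_.fderiv ℝ ψ x) (e i)‖ := by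
          rw [dist_eq_norm, sub_apply]
      _ ≤ ‖_root_.fderiv ℝ ψ y - _root_.fderiv ℝ ψ x‖ * ‖e i‖ :=
          ContinuousLinearMap.le_opNorm _ _
      _ ≤ ε := by rw [norm_e, mul_one]; exact h1.le

/-- Weak harmonicity can be tested against functions that are only `C¹`. -/
theorem IsWeaklyHarmonic.integral_eq_zero {F : Octonion → ℝ} (hF : IsWeaklyHarmonic F)
    {ψ : Octonion → ℝ} (hψ : ContDiff ℝ 1 ψ) (ht : IsTestAwayZero ψ) :
    ∫ x, ∑ i, fderiv ℝ F x (e i) * fderiv ℝ ψ x (e i) = 0 := by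
  obtain ⟨K, hK, hK0, hψK, happ⟩ := ht.exists_smooth_approx hψ
  have hK' : K ⊆ {0}ᶜ := fun x hx => by rintro rfl; exact hK0 hx
  have hFc := continuousOn_fderiv_apply hF.1
  have hint : ∀ η : Octonion → ℝ, ContDiff ℝ 1 η → IsTestAwayZero η →
      Integrable fun x => ∑ i, fderiv ℝ F x (e i) * fderiv ℝ η x (e i) := fun η hη hηt =>
    integrable_finsetSum _ fun i _ =>
      ((hηt.fderiv_apply (e i)).of_zero fun x hx => by simp [hx]).integrable
        ((hFc _).mul ((hη.continuous_fderiv one_ne_zero).clm_apply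
          continuous_const).continuousOn)
  have hMint : IntegrableOn (fun x => ∑ i, |fderiv ℝ F x (e i)|) K :=
    (continuousOn_finsetSum _ fun i _ => ((hFc (e i)).mono hK').abs).integrableOn_compact hK
  set M := ∫ x in K, ∑ i, |fderiv ℝ F x (e i)| with hM
  have hM0 : 0 ≤ M := integral_nonneg fun x => Finset.sum_nonneg fun i _ => abs_nonneg _
  -- The integral is at most `ε M` for every `ε`.
  have hbound : ∀ ε : ℝ, 0 < ε →
      |∫ x, ∑ i, fderiv ℝ F x (e i) * fderiv ℝ ψ x (e i)| ≤ ε * M := by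
    intro ε hε
    obtain ⟨η, hη, hηt, hηK, hηε⟩ := happ ε hε
    have h0 := hF.2 η hη hηt
    rw [← sub_zero (∫ x, _), ← h0,
      ← integral_sub (hint ψ hψ ht) (hint η (contDiff_infty.1 hη 1) hηt),
      ← setIntegral_eq_integral_of_forall_compl_eq_zero (s := K), hM, ← integral_const_mul,
      ← Real.norm_eq_abs]
    · refine norm_integral_le_of_norm_le (hMint.const_mul ε) (Eventually.of_forall fun x => ?_)
      rw [← Finset.sum_sub_distrib, Finset.mul_sum]
      refine (norm_sum_le _ _).trans (Finset.sum_le_sum fun i _ => ?_)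
      rw [← mul_sub, norm_mul, Real.norm_eq_abs, Real.norm_eq_abs, abs_sub_comm, mul_comm]
      exact mul_le_mul_of_nonneg_right (hηε x i) (abs_nonneg _)
    · intro x hx
      have h1 : fderiv ℝ ψ x = 0 := image_eq_zero_of_notMem_tsupport fun h =>
        hx (hψK (tsupport_fderiv_subset ℝ h))
      have h2 : fderiv ℝ η x = 0 := image_eq_zero_of_notMem_tsupport fun h =>
        hx (hηK (tsupport_fderiv_subset ℝ h))
      simp [h1, h2]
  by_contra hne
  have hpos := abs_pos.2 hne
  have := hbound (|∫ x, ∑ i, fderiv ℝ F x (e i) * fderiv ℝ ψ x (e i)| / (2 * (M + 1)))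
    (by positivity)
  rw [div_mul_eq_mul_div, le_div_iff₀ (by positivity)] at this
  nlinarith

/-! ### Polar coordinates -/

/-- Positive homogeneity of integer degree away from the origin. -/
def IsPosHomogeneous {V : Type*} [SMul ℝ V] (a : ℤ) (F : Octonion → V) : Prop :=
  ∀ t : ℝ, 0 < t → ∀ x : Octonion, x ≠ 0 → F (t • x) = t ^ a • F x

instance : IsFiniteMeasure areaS7 :=
  inferInstanceAs (IsFiniteMeasure (volume : Measure Octonion).toSphere)

theorem integral_norm_mul_of_isPosHomogeneous (h : ℝ → ℝ) {H : Octonion → ℝ} {d : ℤ}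
    (hH : IsPosHomogeneous d H) :
    ∫ x, h ‖x‖ * H x
      = (∫ η : S7, H η ∂areaS7) * ∫ r in Set.Ioi (0 : ℝ), h r * r ^ (d + 7) := by
  have hdim : Module.finrank ℝ Octonion - 1 = 7 := by simp
  calc ∫ x, h ‖x‖ * H x
      = ∫ x : ({0}ᶜ : Set Octonion), h ‖x.1‖ * H x.1
          ∂((volume : Measure Octonion).comap Subtype.val) := by
        rw [integral_subtype_comap (measurableSet_singleton _).compl fun x => h ‖x‖ * H x,
          restrict_compl_singleton]
    _ = ∫ p : S7 × Set.Ioi (0 : ℝ), H p.1 * (h p.2 * (p.2 : ℝ) ^ d)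
          ∂(areaS7.prod (.volumeIoiPow (Module.finrank ℝ Octonion - 1))) := by
        rw [areaS7,
          ← (volume : Measure Octonion).measurePreserving_homeomorphUnitSphereProd.integral_comp
            (Homeomorph.measurableEmbedding _)]
        refine integral_congr_ae (Eventually.of_forall fun x => ?_)
        have hx : (x : Octonion) ≠ 0 := x.2
        have hn : 0 < ‖(x : Octonion)‖ := norm_pos_iff.2 hx
        have hs : H x = ‖(x : Octonion)‖ ^ d • H (‖(x : Octonion)‖⁻¹ • x) := by
          rw [← hH _ hn _ (smul_ne_zero (inv_ne_zero hn.ne') hx), smul_inv_smul₀ hn.ne']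
        simp only [homeomorphUnitSphereProd_apply_fst_coe, homeomorphUnitSphereProd_apply_snd_coe]
        rw [hs, smul_eq_mul]
        ring
    _ = (∫ η : S7, H η ∂areaS7) * ∫ r : Set.Ioi (0 : ℝ), h r * (r : ℝ) ^ d
          ∂(.volumeIoiPow (Module.finrank ℝ Octonion - 1)) :=
        integral_prod_mul (fun η : S7 => H η) (fun r : Set.Ioi (0 : ℝ) => h r * (r : ℝ) ^ d)
    _ = _ := by
        congr 1
        simp only [hdim, Measure.volumeIoiPow, ENNReal.ofReal]
        rw [integral_withDensity_eq_integral_smul,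
          integral_subtype_comap measurableSet_Ioi
            fun r : ℝ => Real.toNNReal (r ^ 7) • (h r * r ^ d)]
        · refine setIntegral_congr_fun measurableSet_Ioi fun r hr => ?_
          have hr : 0 < r := hr
          rw [NNReal.smul_def, Real.coe_toNNReal _ (pow_nonneg hr.le _), zpow_add₀ hr.ne',
            smul_eq_mul]
          norm_cast
          ring
        · exact (measurable_subtype_coe.pow_const _).real_toNNReal

theorem IsPosHomogeneous.fderiv_apply_self {F : Octonion → ℝ} {a : ℤ} (hF : IsPosHomogeneous a F)
    (hd : ContDiffOn ℝ 1 F {0}ᶜ) {x : Octonion} (hx : x ≠ 0) : fderiv ℝ F x x = a * F x := by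
  have h1 : HasDerivAt (fun t : ℝ => F (t • x)) (fderiv ℝ F x x) 1 := by
    have hx1 : HasFDerivAt F (fderiv ℝ F x) ((1 : ℝ) • x) := by
      rw [one_smul]
      exact (differentiableAt_of_ne hd hx).hasFDerivAt
    have h := (hasDerivAt_id (1 : ℝ)).smul_const x
    rw [one_smul] at h
    exact HasFDerivAt.comp_hasDerivAt (1 : ℝ) hx1 h
  have h2 : HasDerivAt (fun t : ℝ => F (t • x)) (a * F x) 1 := by
    have := (hasDerivAt_zpow a (1 : ℝ) (Or.inl one_ne_zero)).mul_const (F x)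
    simp only [one_zpow, mul_one] at this
    refine this.congr_of_eventuallyEq ?_
    filter_upwards [lt_mem_nhds (zero_lt_one (α := ℝ))] with t ht
    rw [hF t ht x hx, smul_eq_mul]
  exact h1.unique h2

theorem IsPosHomogeneous.sum_fderiv {F : Octonion → ℝ} {a : ℤ} (hF : IsPosHomogeneous a F)
    (hd : ContDiffOn ℝ 1 F {0}ᶜ) {x : Octonion} (hx : x ≠ 0) :
    ∑ i, x i * fderiv ℝ F x (e i) = a * F x := by
  rw [← hF.fderiv_apply_self hd hx]
  have h := congrArg (fderiv ℝ F x) (sum_smul_e x)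
  rw [map_sum] at h
  simpa using h

/-! ### Orthogonality on the sphere -/

/-- A bump function on the line, around `1` and away from `0`; it cuts off `‖x‖ ^ 2`. -/
noncomputable def radialBump : ContDiffBump (1 : ℝ) := ⟨1 / 4, 1 / 2, by norm_num, by norm_num⟩

theorem radialBump_eq_zero {s : ℝ} (hs : ¬(1 / 2 < s ∧ s < 3 / 2)) : radialBump s = 0 := by
  refine radialBump.zero_of_le_dist ?_
  by_contra h
  refine hs ?_
  have h' : |s - 1| < 1 / 2 := by simpa [Real.dist_eq, radialBump] using h
  rw [abs_lt] at h'
  constructor <;> linarith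

theorem deriv_radialBump_eq_zero {s : ℝ} (hs : ¬(1 / 2 ≤ s ∧ s ≤ 3 / 2)) :
    deriv radialBump s = 0 := by
  have : (fun s => radialBump s) =ᶠ[𝓝 s] fun _ => (0 : ℝ) := by
    have hopen : IsOpen {s : ℝ | ¬(1 / 2 ≤ s ∧ s ≤ 3 / 2)} := isClosed_Icc.isOpen_compl
    filter_upwards [hopen.mem_nhds hs] with t ht
    exact radialBump_eq_zero fun h => ht ⟨h.1.le, h.2.le⟩
  rw [this.deriv_eq, deriv_const]

theorem isTestAwayZero_radialBump : IsTestAwayZero fun x : Octonion => radialBump (‖x‖ ^ 2) := by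
  have hsub : tsupport (fun x : Octonion => radialBump (‖x‖ ^ 2)) ⊆
      {x | 1 / 2 ≤ ‖x‖ ^ 2 ∧ ‖x‖ ^ 2 ≤ 3 / 2} := by
    have hcl : IsClosed {x : Octonion | 1 / 2 ≤ ‖x‖ ^ 2 ∧ ‖x‖ ^ 2 ≤ 3 / 2} :=
      isClosed_Icc.preimage (f := fun x : Octonion => ‖x‖ ^ 2) (by fun_prop)
    refine closure_minimal (fun x hx => ?_) hcl
    by_contra h
    exact hx (radialBump_eq_zero fun h' => h ⟨h'.1.le, h'.2.le⟩)
  constructor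
  · refine (isCompact_closedBall (0 : Octonion) 2).of_isClosed_subset (isClosed_tsupport _)
      fun x hx => ?_
    have := (hsub hx).2
    rw [mem_closedBall_zero_iff]
    nlinarith [norm_nonneg x]
  · intro h
    have := (hsub h).1
    norm_num at this

/-- The radial factor in polar coordinates. For `m = 0` the integrand is the derivative of a
compactly supported function and the integral vanishes. -/
theorem integral_deriv_radialBump_ne_zero {m : ℤ} (hm : m ≠ 0) :
    ∫ r in Set.Ioi (0 : ℝ), (2 * deriv radialBump (r ^ 2)) * r ^ (m + 1) ≠ 0 := by
  have hsm : ContDiff ℝ 1 radialBump := radialBump.contDiff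
  have hw : ∀ r : ℝ, HasDerivAt (fun r => radialBump (r ^ 2))
      (deriv radialBump (r ^ 2) * (2 * r)) r :=
    fun r => by
      have h1 := ((hsm.differentiable one_ne_zero) (r ^ 2)).hasDerivAt
      have h2 : HasDerivAt (fun r : ℝ => r ^ 2) (2 * r) r := by simpa using hasDerivAt_pow 2 r
      exact HasDerivAt.comp (h₂ := radialBump) (h := fun r => r ^ 2) r h1 h2
  have hdc : Continuous (deriv radialBump) := hsm.continuous_deriv le_rfl
  have h1 : ∫ r in Set.Ioi (0 : ℝ), (2 * deriv radialBump (r ^ 2)) * r ^ (m + 1)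
      = ∫ r in (1 / 2 : ℝ)..2, (deriv radialBump (r ^ 2) * (2 * r)) * r ^ m := by
    have hsub : Set.Ioc (1 / 2 : ℝ) 2 ⊆ Set.Ioi 0 := fun r hr => lt_trans (by norm_num) hr.1
    rw [intervalIntegral.integral_of_le (by norm_num),
      setIntegral_eq_of_subset_of_forall_sdiff_eq_zero measurableSet_Ioi hsub]
    · refine setIntegral_congr_fun measurableSet_Ioc fun r hr => ?_
      have hr0 : r ≠ 0 := ne_of_gt (hsub hr)
      rw [zpow_add_one₀ hr0]
      ring
    · rintro r ⟨hr, hr'⟩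
      have hr : 0 < r := hr
      rw [deriv_radialBump_eq_zero, mul_zero, zero_mul]
      rintro ⟨h1, h2⟩
      exact hr' ⟨by nlinarith, by nlinarith⟩
  have hne : ∀ r ∈ Set.uIcc (1 / 2 : ℝ) 2, r ≠ 0 := fun r hr => by
    rw [Set.uIcc_of_le (by norm_num)] at hr
    exact (lt_of_lt_of_le (by norm_num) hr.1).ne'
  have hzc : ∀ n : ℤ, ContinuousOn (fun r : ℝ => r ^ n) (Set.uIcc (1 / 2 : ℝ) 2) := fun n =>
    continuousOn_id.zpow₀ n fun r hr => Or.inl (hne r hr)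
  have h2 := intervalIntegral.integral_deriv_mul_eq_sub (a := (1 / 2 : ℝ)) (b := 2)
    (u := fun r => radialBump (r ^ 2)) (v := fun r => r ^ m)
    (fun r _ => hw r) (fun r hr => hasDerivAt_zpow m r (Or.inl (hne r hr)))
    (by apply Continuous.intervalIntegrable; fun_prop)
    (((hzc (m - 1)).const_smul (m : ℝ)).intervalIntegrable)
  have hb2 : radialBump ((2 : ℝ) ^ 2) = 0 := radialBump_eq_zero (by norm_num)
  have hb1 : radialBump ((1 / 2 : ℝ) ^ 2) = 0 := radialBump_eq_zero (by norm_num)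
  have hcw : Continuous fun r : ℝ => radialBump (r ^ 2) := radialBump.continuous.comp (by fun_prop)
  rw [hb1, hb2, zero_mul, zero_mul, sub_zero, intervalIntegral.integral_add] at h2
  · have hpos : 0 < ∫ r in (1 / 2 : ℝ)..2, radialBump (r ^ 2) * r ^ (m - 1) := by
      refine intervalIntegral.integral_pos (by norm_num) ?_ ?_ ⟨1, by norm_num, ?_⟩
      · rw [← Set.uIcc_of_le (by norm_num)]
        exact hcw.continuousOn.mul (hzc _)
      · intro r hr
        exact mul_nonneg radialBump.nonneg (zpow_nonneg (lt_trans (by norm_num) hr.1).le _)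
      · simpa using radialBump.pos_of_mem_ball (by simp [radialBump])
    rw [h1]
    intro h0
    rw [h0, zero_add] at h2
    have h3 : (m : ℝ) * ∫ r in (1 / 2 : ℝ)..2, radialBump (r ^ 2) * r ^ (m - 1) = 0 := by
      rw [← h2, ← intervalIntegral.integral_const_mul]
      congr 1
      ext r
      ring
    rcases mul_eq_zero.1 h3 with h | h
    · exact hm (by exact_mod_cast h)
    · exact hpos.ne' h
  · have hc : Continuous fun r : ℝ => deriv radialBump (r ^ 2) * (2 * r) := by fun_prop
    exact (hc.continuousOn.mul (hzc m)).intervalIntegrable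
  · exact (hcw.continuousOn.mul ((hzc (m - 1)).const_smul (m : ℝ))).intervalIntegrable

/-- Homogeneous weakly harmonic functions of degrees `a` and `b` are orthogonal on the sphere,
unless their degrees agree or are exchanged by the Kelvin transform `a ↦ -6 - a`. -/
theorem IsWeaklyHarmonic.integral_sphere_mul_eq_zero {F G : Octonion → ℝ} {a b : ℤ}
    (hF : IsWeaklyHarmonic F) (hG : IsWeaklyHarmonic G) (hFa : IsPosHomogeneous a F)
    (hGb : IsPosHomogeneous b G) (hab : a ≠ b) (hab' : a + b + 6 ≠ 0) :
    ∫ η : S7, F η * G η ∂areaS7 = 0 := by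
  set φ : Octonion → ℝ := fun x => radialBump (‖x‖ ^ 2) with hφ
  have hsm : ContDiff ℝ 1 radialBump := radialBump.contDiff
  have hφc : ContDiff ℝ 1 φ := hsm.comp (contDiff_norm_sq ℝ)
  have hdc : Continuous (deriv radialBump) := hsm.continuous_deriv le_rfl
  have hφd : ∀ x i, fderiv ℝ φ x (e i) = 2 * deriv radialBump (‖x‖ ^ 2) * x i := fun x i => by
    have h := HasDerivAt.comp_hasFDerivAt (f := fun y : Octonion => ‖y‖ ^ 2) x
      ((hsm.differentiable one_ne_zero) (‖x‖ ^ 2)).hasDerivAt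
      (hasStrictFDerivAt_norm_sq x).hasFDerivAt
    have h' : fderiv ℝ φ x = _ := h.fderiv
    rw [h']
    simp [inner_e_right]
    ring
  have hdφ0 : IsTestAwayZero fun x : Octonion => 2 * deriv radialBump (‖x‖ ^ 2) := by
    refine isTestAwayZero_radialBump.fderiv.of_zero fun x hx => ?_
    by_contra hne
    have hx0 : x = 0 := by
      ext i
      have := hφd x i
      rw [hφ, hx] at this
      simpa [hne] using this.symm
    subst hx0
    exact hne (by rw [deriv_radialBump_eq_zero (by norm_num), mul_zero])
  set S := ∫ x, φ x * ∑ i, fderiv ℝ F x (e i) * fderiv ℝ G x (e i) with hS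
  set R := ∫ x, 2 * deriv radialBump (‖x‖ ^ 2) * (F x * G x) with hR
  have hFc := continuousOn_fderiv_apply hF.1
  have hGc := continuousOn_fderiv_apply hG.1
  have hintS : Integrable fun x => φ x * ∑ i, fderiv ℝ F x (e i) * fderiv ℝ G x (e i) :=
    (isTestAwayZero_radialBump.of_zero fun x hx => by rw [hφ]; simp [hx]).integrable
      (hφc.continuous.continuousOn.mul (continuousOn_finsetSum _ fun i _ => (hFc _).mul (hGc _)))
  have hintR : Integrable fun x => 2 * deriv radialBump (‖x‖ ^ 2) * (F x * G x) :=
    (hdφ0.of_zero fun x hx => by rw [hx, zero_mul]).integrable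
      (ContinuousOn.mul
        (by fun_prop : Continuous fun x : Octonion => 2 * deriv radialBump (‖x‖ ^ 2)).continuousOn
        (hF.1.continuousOn.mul hG.1.continuousOn))
  -- Green's identity for the test function `φ K`, using Euler's relation for `H`.
  have green : ∀ (H K : Octonion → ℝ) (c : ℤ), IsWeaklyHarmonic H → IsPosHomogeneous c H →
      IsWeaklyHarmonic K → ∫ x, ((c : ℝ) * (2 * deriv radialBump (‖x‖ ^ 2) * (H x * K x))
        + φ x * ∑ i, fderiv ℝ H x (e i) * fderiv ℝ K x (e i)) = 0 := by
    intro H K c hH hHc hK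
    have ht : IsTestAwayZero fun x => φ x * K x :=
      isTestAwayZero_radialBump.of_zero fun x hx => by rw [hφ]; simp [hx]
    have hc : ContDiff ℝ 1 fun x => φ x * K x := contDiff_iff_contDiffAt.2 fun x => by
      by_cases hx : x ∈ tsupport fun x => φ x * K x
      · exact hφc.contDiffAt.mul
          (hK.1.contDiffAt (isOpen_compl_singleton.mem_nhds (ht.ne_zero_of_mem hx)))
      · exact contDiffAt_const.congr_of_eventuallyEq (notMem_tsupport_iff_eventuallyEq.1 hx)
    rw [← hH.integral_eq_zero hc ht]
    refine integral_congr_ae ?_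
    filter_upwards [compl_mem_ae_iff.2 (measure_singleton (0 : Octonion))] with x hx
    have hd : ∀ i, fderiv ℝ (fun x => φ x * K x) x (e i)
        = φ x * fderiv ℝ K x (e i) + 2 * deriv radialBump (‖x‖ ^ 2) * x i * K x := fun i => by
      rw [fderiv_fun_mul ((hφc.differentiable one_ne_zero) x) (differentiableAt_of_ne hK.1 hx),
        ← hφd]
      simp [mul_comm]
    have heul := hHc.sum_fderiv hH.1 hx
    calc _ = 2 * deriv radialBump (‖x‖ ^ 2) * K x * (c * H x)
          + φ x * ∑ i, fderiv ℝ H x (e i) * fderiv ℝ K x (e i) := by ring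
      _ = _ := by
        rw [← heul, Finset.mul_sum, Finset.mul_sum, ← Finset.sum_add_distrib]
        refine Finset.sum_congr rfl fun i _ => ?_
        rw [hd]
        ring
  have e1 : (a : ℝ) * R + S = 0 := by
    rw [← green F G a hF hFa hG, integral_add (hintR.const_mul _) hintS, integral_const_mul]
  have e2 : (b : ℝ) * R + S = 0 := by
    rw [← green G F b hG hGb hF, ← integral_const_mul, ← integral_add (hintR.const_mul _) hintS]
    simp only [mul_comm]
  have hR0 : R = 0 := by
    have : ((a : ℝ) - b) * R = 0 := by linarith
    exact (mul_eq_zero.1 this).resolve_left (sub_ne_zero.2 (by exact_mod_cast hab))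
  have hFG : IsPosHomogeneous (a + b) fun x => F x * G x := fun t ht x hx => by
    simp only [hFa t ht x hx, hGb t ht x hx, zpow_add₀ ht.ne', smul_eq_mul]
    ring
  rw [hR, integral_norm_mul_of_isPosHomogeneous (fun r => 2 * deriv radialBump (r ^ 2)) hFG] at hR0
  refine (mul_eq_zero.1 hR0).resolve_right ?_
  have := integral_deriv_radialBump_ne_zero hab'
  rwa [show a + b + 6 + 1 = a + b + 7 by ring] at this

/-! ### Orthogonality of homogeneous analytic functions -/

/-- Left analytic functions on `ℝ⁸ \ {0}` that are positively homogeneous of degree `d`. The inner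
and outer spherical analytics of order `k` are those of degrees `k` and `-(k + 7)`. -/
def IsHomogAnalytic (d : ℤ) (f : Octonion → Octonion) : Prop :=
  IsLeftAnalyticOn f {0}ᶜ ∧ IsPosHomogeneous d f

theorem IsOuterSpherical.isHomogAnalytic {k : ℕ} {f : Octonion → Octonion}
    (hf : IsOuterSpherical k f) : IsHomogAnalytic (-((k : ℤ) + 7)) f :=
  ⟨hf.2, hf.1⟩

theorem MvPolynomial.IsHomogeneous.eval_mul_left {σ R : Type*} [CommSemiring R]
    {p : MvPolynomial σ R} {n : ℕ} (hp : p.IsHomogeneous n) (t : R) (x : σ → R) :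
    MvPolynomial.eval (fun i => t * x i) p = t ^ n * MvPolynomial.eval x p := by
  simp only [MvPolynomial.eval_eq, Finset.mul_sum]
  refine Finset.sum_congr rfl fun d hd => ?_
  have hdeg : ∑ i ∈ d.support, d i = n := by
    have := hp (MvPolynomial.mem_support_iff.1 hd)
    simpa [Finsupp.weight_apply, Finsupp.sum] using this
  simp only [mul_pow, Finset.prod_mul_distrib, Finset.prod_pow_eq_pow_sum, hdeg]
  ring

theorem IsInnerSpherical.isHomogAnalytic {k : ℕ} {f : Octonion → Octonion}
    (hf : IsInnerSpherical k f) : IsHomogAnalytic k f := by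
  obtain ⟨⟨c, hc, hcf⟩, -, h1, h2⟩ := hf
  refine ⟨⟨isOpen_compl_singleton, h1.mono (Set.subset_univ _), fun x _ => h2 x (Set.mem_univ x)⟩,
    fun t _ x _ => ?_⟩
  ext i
  rw [PiLp.smul_apply, hcf, hcf]
  simpa using (hc i).eval_mul_left t fun j => x j

namespace IsHomogAnalytic

variable {a b : ℤ} {f g : Octonion → Octonion}

theorem continuous_restrictS7 (hf : IsHomogAnalytic a f) : Continuous (restrictS7 f) :=
  hf.1.2.1.continuousOn.comp_continuous continuous_subtype_val fun η =>
    ne_zero_of_mem_unit_sphere η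

theorem memLp_restrictS7 (hf : IsHomogAnalytic a f) : MemLp (restrictS7 f) 2 areaS7 :=
  hf.continuous_restrictS7.memLp_of_hasCompactSupport (.of_compactSpace _)

theorem isPosHomogeneous_mul (hf : IsHomogAnalytic a f) :
    IsPosHomogeneous (a + 1) fun x => x ⊛ f x := fun t ht x hx => by
  simp only [hf.2 t ht x hx, Octonion.mul_smul, smul_mul, smul_smul, zpow_add_one₀ ht.ne']

end IsHomogAnalytic

/-- Orthogonality for octonion-valued functions with weakly harmonic components, one of them
composed with a linear map of the octonions. -/
theorem integral_inner_clm_eq_zero {F G : Octonion → Octonion} {a b : ℤ}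
    (hF : ∀ w, IsWeaklyHarmonic fun x => inner ℝ (F x) w)
    (hG : ∀ w, IsWeaklyHarmonic fun x => inner ℝ (G x) w) (hFa : IsPosHomogeneous a F)
    (hGb : IsPosHomogeneous b G) (hab : a ≠ b) (hab' : a + b + 6 ≠ 0)
    (T : Octonion →L[ℝ] Octonion) :
    ∫ η : S7, inner ℝ (F η) (T (G η)) ∂areaS7 = 0 := by
  have hexp : ∀ x y : Octonion, inner ℝ x (T y)
      = ∑ i, inner ℝ x (e i) * inner ℝ y (ContinuousLinearMap.adjoint T (e i)) := fun x y => by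
    simp only [ContinuousLinearMap.adjoint_inner_right, inner_e_right]
    rw [PiLp.inner_apply]
    exact Finset.sum_congr rfl fun i _ => by simp [mul_comm]
  have hcont : ∀ {H : Octonion → ℝ}, IsWeaklyHarmonic H → Continuous fun η : S7 => H η :=
    fun hH => hH.1.continuousOn.comp_continuous continuous_subtype_val fun η =>
      ne_zero_of_mem_unit_sphere η
  simp only [hexp]
  rw [integral_finsetSum]
  · refine Finset.sum_eq_zero fun i _ => ?_
    refine (hF (e i)).integral_sphere_mul_eq_zero (hG _) (a := a) (b := b) ?_ ?_ hab hab'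
    · exact fun t ht x hx => by simp only [hFa t ht x hx, real_inner_smul_left, smul_eq_mul]
    · exact fun t ht x hx => by simp only [hGb t ht x hx, real_inner_smul_left, smul_eq_mul]
  · intro i _
    exact ((hcont (hF _)).mul (hcont (hG _))).integrable_of_hasCompactSupport (.of_compactSpace _)

/-! ### The form `(f, g)` on `L²(S⁷)` -/

theorem norm_sphereInner_integrand (η : S7) (x y : Octonion) :
    ‖(conj y ⊛ conj η) ⊛ ((η : Octonion) ⊛ x)‖ = ‖x‖ * ‖y‖ := by
  simp [Octonion.norm_mul, norm_conj, mul_comm]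

theorem integrable_sphereInner {f g : S7 → Octonion} (hf : MemLp f 2 areaS7)
    (hg : MemLp g 2 areaS7) :
    Integrable (fun η : S7 => (conj (g η) ⊛ conj η) ⊛ ((η : Octonion) ⊛ f η)) areaS7 := by
  have hη : AEStronglyMeasurable (fun η : S7 => (η : Octonion)) areaS7 :=
    continuous_subtype_val.aestronglyMeasurable
  have hm : AEStronglyMeasurable
      (fun η : S7 => (conj (g η) ⊛ conj η) ⊛ ((η : Octonion) ⊛ f η)) areaS7 :=
    mulL.aestronglyMeasurable_comp₂
      (mulL.aestronglyMeasurable_comp₂ (conjL.continuous.comp_aestronglyMeasurable hg.1)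
        (conjL.continuous.comp_aestronglyMeasurable hη))
      (mulL.aestronglyMeasurable_comp₂ hη hf.1)
  exact (hf.norm.integrable_mul hg.norm).mono' hm
    (Eventually.of_forall fun η => (norm_sphereInner_integrand η _ _).le)

theorem inner_sphereInner {f g : S7 → Octonion} (hf : MemLp f 2 areaS7)
    (hg : MemLp g 2 areaS7) (u : Octonion) :
    inner ℝ (sphereInner f g) u = (areaS7.real Set.univ)⁻¹ *
      ∫ η : S7, inner ℝ ((η : Octonion) ⊛ f η) (((η : Octonion) ⊛ g η) ⊛ u) ∂areaS7 := by
  rw [sphereInner, real_inner_smul_left, real_inner_comm,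
    ← integral_inner (integrable_sphereInner hf hg)]
  simp only [← conj_mul, real_inner_comm _ u, inner_conj_mul]

/-- Multiplication by `x` produces functions with harmonic components, so that homogeneous analytic
functions are orthogonal for the octonionic form unless the degrees of `x f` and `x g` agree or are
Kelvin dual. -/
theorem IsHomogAnalytic.sphereInner_eq_zero {a b : ℤ} {f g : Octonion → Octonion}
    (hf : IsHomogAnalytic a f) (hg : IsHomogAnalytic b g) (hab : a ≠ b) (hab' : a + b + 8 ≠ 0) :
    sphereInner (restrictS7 f) (restrictS7 g) = 0 := by
  refine ext_inner_right ℝ fun u => ?_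
  rw [inner_sphereInner hf.memLp_restrictS7 hg.memLp_restrictS7, inner_zero_left]
  have h := integral_inner_clm_eq_zero (isWeaklyHarmonic_inner_mul hf.1)
    (isWeaklyHarmonic_inner_mul hg.1) hf.isPosHomogeneous_mul hg.isPosHomogeneous_mul
    (by omega) (by omega) (mulL.flip u)
  exact mul_eq_zero_of_right _ h

theorem inner_mul_mul_sphere (η : S7) (x y : Octonion) :
    inner ℝ ((η : Octonion) ⊛ x) ((η : Octonion) ⊛ y) = inner ℝ x y := by
  rw [inner_mul_left, conj_mul_mul]
  simp

/-- In real `L²`, the orthogonality of `f` and `g` can be seen from the degrees of `f`, `g` as well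
as from those of `x f`, `x g`; the exceptional pairs of degrees are disjoint. -/
theorem IsHomogAnalytic.integral_inner_eq_zero {a b : ℤ} {f g : Octonion → Octonion}
    (hf : IsHomogAnalytic a f) (hg : IsHomogAnalytic b g) (hab : a ≠ b) :
    ∫ η : S7, inner ℝ (restrictS7 f η) (restrictS7 g η) ∂areaS7 = 0 := by
  by_cases hab' : a + b + 8 = 0
  · exact integral_inner_clm_eq_zero (isWeaklyHarmonic_inner_const hf.1)
      (isWeaklyHarmonic_inner_const hg.1) hf.2 hg.2 hab (by omega) (.id ℝ Octonion)
  · have h := integral_inner_clm_eq_zero (isWeaklyHarmonic_inner_mul hf.1)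
      (isWeaklyHarmonic_inner_mul hg.1) hf.isPosHomogeneous_mul hg.isPosHomogeneous_mul
      (by omega) (by omega) (.id ℝ Octonion)
    simpa only [ContinuousLinearMap.id_apply, inner_mul_mul_sphere, restrictS7] using h

theorem sphereInner_congr_ae {f f' g g' : S7 → Octonion} (hf : f =ᵐ[areaS7] f')
    (hg : g =ᵐ[areaS7] g') : sphereInner f g = sphereInner f' g' := by
  rw [sphereInner, sphereInner]
  congr 1
  refine integral_congr_ae ?_
  filter_upwards [hf, hg] with η h1 h2
  rw [h1, h2]

theorem sphereInner_add_left {f f' g : S7 → Octonion} (hf : MemLp f 2 areaS7)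
    (hf' : MemLp f' 2 areaS7) (hg : MemLp g 2 areaS7) :
    sphereInner (f + f') g = sphereInner f g + sphereInner f' g := by
  simp only [sphereInner, Pi.add_apply, Octonion.mul_add]
  rw [integral_add (integrable_sphereInner hf hg) (integrable_sphereInner hf' hg), smul_add]

theorem sphereInner_add_right {f g g' : S7 → Octonion} (hf : MemLp f 2 areaS7)
    (hg : MemLp g 2 areaS7) (hg' : MemLp g' 2 areaS7) :
    sphereInner f (g + g') = sphereInner f g + sphereInner f g' := by
  simp only [sphereInner, Pi.add_apply, conj_add, Octonion.add_mul]
  rw [integral_add (integrable_sphereInner hf hg) (integrable_sphereInner hf hg'), smul_add]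

theorem sphereInner_smul_left (c : ℝ) (f g : S7 → Octonion) :
    sphereInner (c • f) g = c • sphereInner f g := by
  simp only [sphereInner, Pi.smul_apply, Octonion.mul_smul]
  rw [integral_smul, smul_comm]

theorem conj_smul (c : ℝ) (x : Octonion) : conj (c • x) = c • conj x := conjL.map_smul c x

theorem sphereInner_smul_right (c : ℝ) (f g : S7 → Octonion) :
    sphereInner f (c • g) = c • sphereInner f g := by
  simp only [sphereInner, Pi.smul_apply, conj_smul, smul_mul]
  rw [integral_smul, smul_comm]

theorem norm_sphereInner_le (u v : Lp Octonion 2 areaS7) :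
    ‖sphereInner u v‖ ≤ (areaS7.real Set.univ)⁻¹ * ‖u‖ * ‖v‖ := by
  have hu := (Lp.memLp u).norm
  have hv := (Lp.memLp v).norm
  rw [sphereInner, norm_smul, norm_inv, Real.norm_of_nonneg measureReal_nonneg, mul_assoc]
  refine mul_le_mul_of_nonneg_left ?_ (inv_nonneg.2 measureReal_nonneg)
  calc _ ≤ ∫ η, ‖u η‖ * ‖v η‖ ∂areaS7 := by
        refine (norm_integral_le_integral_norm _).trans (le_of_eq ?_)
        simp only [norm_sphereInner_integrand]
    _ = inner ℝ (hu.toLp _) (hv.toLp _) := by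
        rw [L2.inner_def]
        refine integral_congr_ae ?_
        filter_upwards [hu.coeFn_toLp, hv.coeFn_toLp] with η h1 h2
        rw [h1, h2]
        simp [mul_comm]
    _ ≤ ‖hu.toLp _‖ * ‖hv.toLp _‖ := real_inner_le_norm _ _
    _ = ‖u‖ * ‖v‖ := by
        rw [Lp.norm_toLp, Lp.norm_toLp, eLpNorm_norm, eLpNorm_norm, Lp.norm_def, Lp.norm_def]

/-- The octonionic form as a bounded real bilinear map on `L²(S⁷)`. -/
noncomputable def sphereForm :
    Lp Octonion 2 areaS7 →L[ℝ] Lp Octonion 2 areaS7 →L[ℝ] Octonion :=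
  LinearMap.mkContinuous₂
    (LinearMap.mk₂ ℝ (fun u v : Lp Octonion 2 areaS7 => sphereInner u v)
      (fun u u' v => by
        rw [sphereInner_congr_ae (Lp.coeFn_add u u') (ae_eq_refl v),
          sphereInner_add_left (Lp.memLp u) (Lp.memLp u') (Lp.memLp v)])
      (fun c u v => by
        rw [sphereInner_congr_ae (Lp.coeFn_smul c u) (ae_eq_refl v), sphereInner_smul_left])
      (fun u v v' => by
        rw [sphereInner_congr_ae (ae_eq_refl u) (Lp.coeFn_add v v'),
          sphereInner_add_right (Lp.memLp u) (Lp.memLp v) (Lp.memLp v')])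
      (fun c u v => by
        rw [sphereInner_congr_ae (ae_eq_refl u) (Lp.coeFn_smul c v), sphereInner_smul_right]))
    (areaS7.real Set.univ)⁻¹ norm_sphereInner_le

theorem sphereForm_toLp {f g : S7 → Octonion} (hf : MemLp f 2 areaS7) (hg : MemLp g 2 areaS7) :
    sphereForm (hf.toLp f) (hg.toLp g) = sphereInner f g :=
  sphereInner_congr_ae hf.coeFn_toLp hg.coeFn_toLp

theorem inner_toLp {f g : S7 → Octonion} (hf : MemLp f 2 areaS7) (hg : MemLp g 2 areaS7) :
    inner ℝ (hf.toLp f) (hg.toLp g) = ∫ η, inner ℝ (f η) (g η) ∂areaS7 := by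
  rw [L2.inner_def]
  refine integral_congr_ae ?_
  filter_upwards [hf.coeFn_toLp, hg.coeFn_toLp] with η h1 h2
  rw [h1, h2]

/-! ### Expansions in a Hilbert space -/

/-- Bessel's inequality for the two families of an expansion. -/
theorem summable_norm_sq_of_tendsto {H : Type*} [NormedAddCommGroup H] [InnerProductSpace ℝ H]
    {p q : ℕ → H} {f : H} (hpp : ∀ k l, k ≠ l → inner ℝ (p k) (p l) = 0)
    (hqq : ∀ k l, k ≠ l → inner ℝ (q k) (q l) = 0) (hpq : ∀ k l, inner ℝ (p k) (q l) = 0)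
    (hf : Tendsto (fun n => ∑ k ∈ Finset.range n, (p k + q k)) atTop (𝓝 f)) :
    Summable (fun k => ‖p k‖ ^ 2) ∧ Summable (fun k => ‖q k‖ ^ 2) := by
  have hqp : ∀ k l, inner ℝ (q k) (p l) = 0 := fun k l => by rw [real_inner_comm, hpq]
  have hU : ∀ k, ‖p k + q k‖ ^ 2 = ‖p k‖ ^ 2 + ‖q k‖ ^ 2 := fun k => by
    rw [norm_add_sq_real, hpq]
    ring
  have hS : ∀ n, ‖∑ k ∈ Finset.range n, (p k + q k)‖ ^ 2
      = ∑ k ∈ Finset.range n, (‖p k‖ ^ 2 + ‖q k‖ ^ 2) := fun n => by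
    induction n with
    | zero => simp
    | succ n ih =>
      have h0 : inner ℝ (∑ k ∈ Finset.range n, (p k + q k)) (p n + q n) = 0 := by
        rw [sum_inner]
        refine Finset.sum_eq_zero fun k hk => ?_
        have hkn : k ≠ n := (Finset.mem_range.1 hk).ne
        simp [inner_add_left, inner_add_right, hpp k n hkn, hqq k n hkn, hpq, hqp]
      rw [Finset.sum_range_succ, Finset.sum_range_succ, norm_add_sq_real, h0, ih, hU]
      ring
  have hlim : Tendsto (fun n => ∑ k ∈ Finset.range n, (‖p k‖ ^ 2 + ‖q k‖ ^ 2)) atTop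
      (𝓝 (‖f‖ ^ 2)) := by
    simpa only [hS] using (hf.norm.pow 2)
  have hsum : Summable fun k => ‖p k‖ ^ 2 + ‖q k‖ ^ 2 :=
    ((hasSum_iff_tendsto_nat_of_nonneg (fun k => by positivity) _).2 hlim).summable
  exact ⟨hsum.of_nonneg_of_le (fun k => by positivity) fun k => by linarith [sq_nonneg ‖q k‖],
    hsum.of_nonneg_of_le (fun k => by positivity) fun k => by linarith [sq_nonneg ‖p k‖]⟩

theorem summable_bilinear_of_summable_norm_sq {H V : Type*} [NormedAddCommGroup H]
    [NormedSpace ℝ H] [NormedAddCommGroup V] [NormedSpace ℝ V] [CompleteSpace V]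
    (B : H →L[ℝ] H →L[ℝ] V) {u v : ℕ → H} (hu : Summable fun k => ‖u k‖ ^ 2)
    (hv : Summable fun k => ‖v k‖ ^ 2) : Summable fun k => B (u k) (v k) := by
  refine Summable.of_norm_bounded ((hu.add hv).mul_left ‖B‖) fun k => ?_
  refine (B.le_opNorm₂ _ _).trans ?_
  rw [mul_assoc]
  refine mul_le_mul_of_nonneg_left ?_ (norm_nonneg B)
  nlinarith [sq_nonneg (‖u k‖ - ‖v k‖), mul_nonneg (norm_nonneg (u k)) (norm_nonneg (v k))]

/-- The value of a bounded bilinear form on two expansions when only the diagonal terms and the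
cross terms between `p k` and `q (k + 1)` survive. -/
theorem bilinear_expansion {H V : Type*} [NormedAddCommGroup H]
    [NormedSpace ℝ H] [NormedAddCommGroup V] [NormedSpace ℝ V] [CompleteSpace V]
    (B : H →L[ℝ] H →L[ℝ] V) {p q p' q' : ℕ → H} {f f' : H}
    (hp : Summable fun k => ‖p k‖ ^ 2) (hq : Summable fun k => ‖q k‖ ^ 2)
    (hp' : Summable fun k => ‖p' k‖ ^ 2) (hq' : Summable fun k => ‖q' k‖ ^ 2)
    (hf : Tendsto (fun n => ∑ k ∈ Finset.range n, (p k + q k)) atTop (𝓝 f))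
    (hf' : Tendsto (fun n => ∑ k ∈ Finset.range n, (p' k + q' k)) atTop (𝓝 f'))
    (hpp : ∀ k l, k ≠ l → B (p k) (p' l) = 0) (hqq : ∀ k l, k ≠ l → B (q k) (q' l) = 0)
    (hpq : ∀ k l, l ≠ k + 1 → B (p k) (q' l) = 0)
    (hqp : ∀ k l, k ≠ l + 1 → B (q k) (p' l) = 0) :
    Summable (fun k => B (p k) (p' k) + B (q k) (q' k)) ∧
    Summable (fun k => B (p k) (q' (k + 1)) + B (q (k + 1)) (p' k)) ∧
    B f f' = ∑' k, (B (p k) (p' k) + B (q k) (q' k)) +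
      ∑' k, (B (p k) (q' (k + 1)) + B (q (k + 1)) (p' k)) := by
  have hd : Summable (fun k => B (p k) (p' k) + B (q k) (q' k)) :=
    (summable_bilinear_of_summable_norm_sq B hp hp').add
      (summable_bilinear_of_summable_norm_sq B hq hq')
  have hc : Summable (fun k => B (p k) (q' (k + 1)) + B (q (k + 1)) (p' k)) :=
    (summable_bilinear_of_summable_norm_sq B hp ((summable_nat_add_iff 1).2 hq')).add
      (summable_bilinear_of_summable_norm_sq B ((summable_nat_add_iff 1).2 hq) hp')
  refine ⟨hd, hc, ?_⟩
  set S : ℕ → H := fun n => ∑ k ∈ Finset.range n, (p k + q k) with hS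
  set S' : ℕ → H := fun n => ∑ k ∈ Finset.range n, (p' k + q' k) with hS'
  have hleft : ∀ n, B (S (n + 1)) (p' (n + 1) + q' (n + 1)) = B (p n) (q' (n + 1)) := fun n => by
    rw [hS]
    simp only [map_sum, sum_apply]
    rw [Finset.sum_eq_single_of_mem n (Finset.self_mem_range_succ n)]
    · simp [hpp n (n + 1) (by omega), hqq n (n + 1) (by omega), hqp n (n + 1) (by omega)]
    · intro k hk hkn
      have := Finset.mem_range.1 hk
      simp [hpp k (n + 1) (by omega), hqq k (n + 1) (by omega), hqp k (n + 1) (by omega),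
        hpq k (n + 1) (by omega)]
  have hright : ∀ n, B (p (n + 1) + q (n + 1)) (S' (n + 1)) = B (q (n + 1)) (p' n) := fun n => by
    rw [hS']
    simp only [map_sum]
    rw [Finset.sum_eq_single_of_mem n (Finset.self_mem_range_succ n)]
    · simp [hpp (n + 1) n (by omega), hqq (n + 1) n (by omega), hpq (n + 1) n (by omega)]
    · intro k hk hkn
      have := Finset.mem_range.1 hk
      simp [hpp (n + 1) k (by omega), hqq (n + 1) k (by omega), hqp (n + 1) k (by omega),
        hpq (n + 1) k (by omega)]
  have hdiag : ∀ n, B (p n + q n) (p' n + q' n) = B (p n) (p' n) + B (q n) (q' n) := fun n => by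
    simp [hpq n n (by omega), hqp n n (by omega)]
  have hpart : ∀ n, B (S (n + 1)) (S' (n + 1))
      = ∑ k ∈ Finset.range (n + 1), (B (p k) (p' k) + B (q k) (q' k))
        + ∑ k ∈ Finset.range n, (B (p k) (q' (k + 1)) + B (q (k + 1)) (p' k)) := fun n => by
    induction n with
    | zero =>
      have h := hdiag 0
      simpa [hS, hS'] using h
    | succ n ih =>
      have e1 : S (n + 1 + 1) = S (n + 1) + (p (n + 1) + q (n + 1)) := Finset.sum_range_succ _ _
      have e2 : S' (n + 1 + 1) = S' (n + 1) + (p' (n + 1) + q' (n + 1)) :=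
        Finset.sum_range_succ _ _
      have : B (S (n + 1 + 1)) (S' (n + 1 + 1)) = B (S (n + 1)) (S' (n + 1))
          + B (S (n + 1)) (p' (n + 1) + q' (n + 1)) + (B (p (n + 1) + q (n + 1)) (S' (n + 1))
            + B (p (n + 1) + q (n + 1)) (p' (n + 1) + q' (n + 1))) := by
        rw [e1, e2, map_add B, add_apply, map_add (B (S (n + 1))),
          map_add (B (p (n + 1) + q (n + 1)))]
      rw [this, ih, hleft, hright, hdiag, Finset.sum_range_succ _ (n + 1),
        Finset.sum_range_succ (fun k => B (p k) (q' (k + 1)) + B (q (k + 1)) (p' k)) n]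
      abel
  have hlim1 : Tendsto (fun n => B (S (n + 1)) (S' (n + 1))) atTop (𝓝 (B f f')) := by
    have h := ((B.isBoundedBilinearMap.continuous.tendsto (f, f')).comp (hf.prodMk_nhds hf'))
    exact h.comp (tendsto_add_atTop_nat 1)
  have hlim2 := (hd.hasSum.tendsto_sum_nat.comp (tendsto_add_atTop_nat 1)).add
    hc.hasSum.tendsto_sum_nat
  refine tendsto_nhds_unique hlim1 (hlim2.congr fun n => ?_)
  rw [hpart]
  rfl

/-! ### The expansion formula -/

theorem IsSphericalExpansion.memLp_inner {f : S7 → Octonion} {P Q : ℕ → Octonion → Octonion}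
    (h : IsSphericalExpansion f P Q) (k : ℕ) : MemLp (restrictS7 (P k)) 2 areaS7 :=
  (h.inner k).isHomogAnalytic.memLp_restrictS7

theorem IsSphericalExpansion.memLp_outer {f : S7 → Octonion} {P Q : ℕ → Octonion → Octonion}
    (h : IsSphericalExpansion f P Q) (k : ℕ) : MemLp (restrictS7 (Q k)) 2 areaS7 :=
  (h.outer k).isHomogAnalytic.memLp_restrictS7

theorem IsSphericalExpansion.tendsto_toLp {f : S7 → Octonion} {P Q : ℕ → Octonion → Octonion}
    (h : IsSphericalExpansion f P Q) (hf : MemLp f 2 areaS7) :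
    Tendsto (fun n => ∑ k ∈ Finset.range n,
      ((h.memLp_inner k).toLp (restrictS7 (P k)) + (h.memLp_outer k).toLp (restrictS7 (Q k))))
      atTop (𝓝 (hf.toLp f)) := by
  have hm : ∀ n, MemLp (∑ k ∈ Finset.range n, (restrictS7 (P k) + restrictS7 (Q k))) 2 areaS7 :=
    fun n => memLp_finsetSum' _ fun k _ => (h.memLp_inner k).add (h.memLp_outer k)
  have hS : ∀ n, ∑ k ∈ Finset.range n,
      ((h.memLp_inner k).toLp (restrictS7 (P k)) + (h.memLp_outer k).toLp (restrictS7 (Q k)))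
      = (hm n).toLp _ := fun n => by
    induction n with
    | zero => exact (MemLp.toLp_zero _).symm
    | succ n ih =>
      rw [Finset.sum_range_succ, ih, ← MemLp.toLp_add, ← MemLp.toLp_add]
      congr 1
      rw [Finset.sum_range_succ]
  simp only [hS]
  rw [Lp.tendsto_Lp_iff_tendsto_eLpNorm'']
  refine h.tendsto.congr fun n => ?_
  rw [← eLpNorm_neg]
  congr 1
  ext1 η
  simp

theorem IsSphericalExpansion.summable_norm_sq {f : S7 → Octonion} {P Q : ℕ → Octonion → Octonion}
    (h : IsSphericalExpansion f P Q) (hf : MemLp f 2 areaS7) :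
    Summable (fun k => ‖(h.memLp_inner k).toLp (restrictS7 (P k))‖ ^ 2) ∧
      Summable (fun k => ‖(h.memLp_outer k).toLp (restrictS7 (Q k))‖ ^ 2) := by
  refine summable_norm_sq_of_tendsto (fun k l hkl => ?_) (fun k l hkl => ?_) (fun k l => ?_)
    (h.tendsto_toLp hf) <;> rw [inner_toLp]
  · exact (h.inner k).isHomogAnalytic.integral_inner_eq_zero (h.inner l).isHomogAnalytic (by omega)
  · exact (h.outer k).isHomogAnalytic.integral_inner_eq_zero (h.outer l).isHomogAnalytic (by omega)
  · exact (h.inner k).isHomogAnalytic.integral_inner_eq_zero (h.outer l).isHomogAnalytic (by omega)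

theorem sphereInner_expansion {f g : S7 → Octonion} (hf : MemLp f 2 areaS7)
    (hg : MemLp g 2 areaS7) {Pf Qf Pg Qg : ℕ → Octonion → Octonion}
    (hF : IsSphericalExpansion f Pf Qf) (hG : IsSphericalExpansion g Pg Qg) :
    Summable (fun k : ℕ => sphereInner (restrictS7 (Pf k)) (restrictS7 (Pg k)) +
      sphereInner (restrictS7 (Qf k)) (restrictS7 (Qg k))) ∧
    Summable (fun k : ℕ => sphereInner (restrictS7 (Pf k)) (restrictS7 (Qg (k + 1))) +
      sphereInner (restrictS7 (Qf (k + 1))) (restrictS7 (Pg k))) ∧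
    sphereInner f g =
      ∑' k : ℕ, (sphereInner (restrictS7 (Pf k)) (restrictS7 (Pg k)) +
        sphereInner (restrictS7 (Qf k)) (restrictS7 (Qg k))) +
      ∑' k : ℕ, (sphereInner (restrictS7 (Pf k)) (restrictS7 (Qg (k + 1))) +
        sphereInner (restrictS7 (Qf (k + 1))) (restrictS7 (Pg k))) := by
  have key := bilinear_expansion sphereForm (hF.summable_norm_sq hf).1 (hF.summable_norm_sq hf).2
    (hG.summable_norm_sq hg).1 (hG.summable_norm_sq hg).2 (hF.tendsto_toLp hf)
    (hG.tendsto_toLp hg) (fun k l hkl => ?_) (fun k l hkl => ?_) (fun k l hkl => ?_)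
    (fun k l hkl => ?_)
  · simpa only [sphereForm_toLp] using key
  all_goals rw [sphereForm_toLp]
  · exact (hF.inner k).isHomogAnalytic.sphereInner_eq_zero (hG.inner l).isHomogAnalytic
      (by omega) (by omega)
  · exact (hF.outer k).isHomogAnalytic.sphereInner_eq_zero (hG.outer l).isHomogAnalytic
      (by omega) (by omega)
  · exact (hF.inner k).isHomogAnalytic.sphereInner_eq_zero (hG.outer l).isHomogAnalytic
      (by omega) (by omega)
  · exact (hF.outer k).isHomogAnalytic.sphereInner_eq_zero (hG.inner l).isHomogAnalytic
      (by omega) (by omega)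

/-! ### Nonvanishing cross terms -/

/-- The function `|x|⁻¹⁰ conj x L x` attached to a linear map `L`, of degree `-8`. -/
noncomputable def outerOne (L : Octonion →L[ℝ] Octonion) (x : Octonion) : Octonion :=
  (‖x‖ ^ 2) ^ (-5 : ℤ) • (conj x ⊛ L x)

/-- For linear `L` with `∑ i, conj (e i) L (e i) = 0`, the function `|x|⁻¹⁰ conj x L x` is
outer of order `1`. -/
theorem isOuterSpherical_one (L : Octonion →L[ℝ] Octonion)
    (hL : ∑ i, conj (e i) ⊛ L (e i) = 0) :
    IsOuterSpherical 1 (outerOne L) := by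
  change IsOuterSpherical 1 fun x => (‖x‖ ^ 2) ^ (-5 : ℤ) • (conj x ⊛ L x)
  have hW : ContDiff ℝ 1 fun x => conj x ⊛ L x :=
    mulL.isBoundedBilinearMap.contDiff.comp (conjL.contDiff.prodMk L.contDiff)
  have hWd : ∀ x v, fderiv ℝ (fun x => conj x ⊛ L x) x v = conj x ⊛ L v + conj v ⊛ L x :=
    fun x v => by
      have h : HasFDerivAt (fun x => mulL (conjL x) (L x)) _ x :=
        mulL.hasFDerivAt_of_bilinear conjL.hasFDerivAt L.hasFDerivAt
      have h' : fderiv ℝ (fun x => conj x ⊛ L x) x = _ := h.fderiv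
      rw [h']
      rfl
  have hn : ∀ x : Octonion, x ≠ 0 → HasFDerivAt (fun y : Octonion => (‖y‖ ^ 2) ^ (-5 : ℤ))
      ((((-5 : ℤ) : ℝ) * (‖x‖ ^ 2) ^ (-5 - 1 : ℤ)) • (2 • innerSL ℝ x)) x := fun x hx =>
    HasDerivAt.comp_hasFDerivAt (f := fun y : Octonion => ‖y‖ ^ 2) x
      (hasDerivAt_zpow (-5) (‖x‖ ^ 2) (Or.inl (by positivity)))
      (hasStrictFDerivAt_norm_sq x).hasFDerivAt
  refine ⟨fun t ht x hx => ?_, isOpen_compl_singleton, fun x hx => ?_, fun x hx => ?_⟩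
  · have hx' : ‖x‖ ≠ 0 := norm_ne_zero_iff.2 hx
    simp only [norm_smul, Real.norm_of_nonneg ht.le, map_smul, conj_smul, smul_mul,
      Octonion.mul_smul, smul_smul]
    congr 1
    rw [mul_pow, mul_zpow]
    have : (t ^ 2) ^ (-5 : ℤ) * (t * t) = t ^ (-(((1 : ℕ) : ℤ) + 7)) := by
      have h := ht.ne'
      norm_num [zpow_neg]
      field_simp
    rw [← this]
    ring
  · have hx' : x ≠ 0 := hx
    have h2 : ContDiffAt ℝ 1 (fun y : Octonion => ((‖y‖ ^ 2) ^ 5)⁻¹) x :=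
      ((contDiff_norm_sq ℝ).pow 5).contDiffAt.inv (by positivity)
    have h3 : ContDiffAt ℝ 1 (fun y : Octonion => (‖y‖ ^ 2) ^ (-5 : ℤ)) x := h2
    exact (h3.smul hW.contDiffAt).contDiffWithinAt
  · have hx' : x ≠ 0 := hx
    have hnx : ‖x‖ ^ 2 ≠ 0 := by positivity
    have hd : ∀ i, fderiv ℝ (fun x => (‖x‖ ^ 2) ^ (-5 : ℤ) • (conj x ⊛ L x)) x (e i)
        = (‖x‖ ^ 2) ^ (-5 : ℤ) • (conj x ⊛ L (e i) + conj (e i) ⊛ L x)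
          + (-10 * (‖x‖ ^ 2) ^ (-6 : ℤ) * x i) • (conj x ⊛ L x) := fun i => by
      rw [fderiv_smul_apply (hn x hx').differentiableAt
        (hW.differentiable one_ne_zero x), hWd, (hn x hx').fderiv]
      congr 2
      simp [inner_e_right]
      ring
    have e1 : ∑ i, e i ⊛ (conj x ⊛ L (e i)) = (2 : ℝ) • L x := by
      have h : ∀ i, e i ⊛ (conj x ⊛ L (e i))
          = (2 : ℝ) • (x i • L (e i)) - x ⊛ (conj (e i) ⊛ L (e i)) := fun i => by
        rw [eq_sub_iff_add_eq, mul_conj_mul_add, inner_e_left, smul_smul]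
      simp only [h, Finset.sum_sub_distrib]
      rw [← mul_sum, hL, Octonion.mul_zero, sub_zero, ← Finset.smul_sum]
      simp only [← map_smul, ← map_sum, sum_smul_e]
    have e2 : ∑ i, e i ⊛ (conj (e i) ⊛ L x) = (8 : ℝ) • L x := by
      simp only [mul_conj_mul, norm_e]
      simp
      module
    have e3 : ∑ i, x i • (e i ⊛ (conj x ⊛ L x)) = ‖x‖ ^ 2 • L x := by
      have h := congrArg (mulL.flip (conj x ⊛ L x)) (sum_smul_e x)
      rw [map_sum] at h
      simpa only [map_smul, ContinuousLinearMap.flip_apply, mulL_apply, mul_conj_mul] using h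
    have e4 : (‖x‖ ^ 2) ^ (-6 : ℤ) * ‖x‖ ^ 2 = (‖x‖ ^ 2) ^ (-5 : ℤ) := by
      rw [← zpow_add_one₀ hnx]
      norm_num
    rw [cauchyRiemann]
    simp only [hd, Octonion.mul_add, Octonion.mul_smul, Finset.sum_add_distrib, smul_add]
    simp only [mul_smul, ← Finset.smul_sum, e1, e2, e3]
    rw [← e4]
    module

theorem isInnerSpherical_zero_const (c : Octonion) : IsInnerSpherical 0 fun _ => c := by
  refine ⟨⟨fun i => MvPolynomial.C (c i), fun i => MvPolynomial.isHomogeneous_C _ _,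
    fun x i => by simp⟩, isOpen_univ, contDiffOn_const, fun x _ => ?_⟩
  simp [cauchyRiemann, Octonion.mul_zero]

theorem isInnerSpherical_zero (k : ℕ) : IsInnerSpherical k 0 := by
  refine ⟨⟨fun _ => 0, fun _ => MvPolynomial.isHomogeneous_zero _ _ _, fun x i => by simp⟩,
    isOpen_univ, contDiffOn_const, fun x _ => ?_⟩
  simp [cauchyRiemann, Octonion.mul_zero]

theorem isOuterSpherical_zero (k : ℕ) : IsOuterSpherical k 0 := by
  refine ⟨fun t _ x _ => by simp, isOpen_compl_singleton, contDiffOn_const, fun x _ => ?_⟩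
  simp [cauchyRiemann, Octonion.mul_zero]

theorem isSphericalExpansion_add {P Q : Octonion → Octonion} (hP : IsInnerSpherical 0 P)
    (hQ : IsOuterSpherical 1 Q) :
    IsSphericalExpansion (restrictS7 P + restrictS7 Q) (fun k => if k = 0 then P else 0)
      (fun k => if k = 1 then Q else 0) where
  inner k := by
    by_cases h : k = 0
    · subst h
      simpa using hP
    · simpa [h] using isInnerSpherical_zero k
  outer k := by
    by_cases h : k = 1
    · subst h
      simpa using hQ
    · simpa [h] using isOuterSpherical_zero k
  tendsto := by
    refine tendsto_const_nhds.congr' ?_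
    filter_upwards [eventually_ge_atTop 2] with n hn
    have h : ∀ η : S7, (restrictS7 P + restrictS7 Q) η - ∑ k ∈ Finset.range n,
        (restrictS7 (if k = 0 then P else 0) η + restrictS7 (if k = 1 then Q else 0) η) = 0 := by
      intro η
      have h0 : 0 < n := by omega
      have h1 : 1 < n := by omega
      have hr : ∀ (c : Prop) [Decidable c] (R : Octonion → Octonion),
          restrictS7 (if c then R else 0) η = if c then restrictS7 R η else 0 := fun c _ R => by
        split_ifs <;> rfl
      simp [hr, Finset.sum_add_distrib, Finset.sum_ite_eq', h0, h1]
    simp only [h, eLpNorm_zero']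

/-- The linear map `x ↦ -x₂ + x₄ e₆`, annihilated by the conjugate operator. -/
noncomputable def crossMap : Octonion →L[ℝ] Octonion :=
  (EuclideanSpace.proj 4 : Octonion →L[ℝ] ℝ).smulRight (e 6)
    - (EuclideanSpace.proj 2 : Octonion →L[ℝ] ℝ).smulRight (e 0)

theorem crossMap_apply (x : Octonion) : crossMap x = x 4 • e 6 - x 2 • e 0 := rfl

theorem sum_conj_mul_crossMap : ∑ i, conj (e i) ⊛ crossMap (e i) = 0 := by
  have h2 : conj (e 2) ⊛ e 0 = conj (e 2) := mul_e_zero _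
  have h4 : conj (e 4) ⊛ e 6 = conj (e 2) := by
    obtain ⟨h0, h1, h2, h3, h4, h5, h6, h7⟩ := mul_coords (conj (e 4)) (e 6)
    ext i
    fin_cases i <;> simp [h0, h1, h2, h3, h4, h5, h6, h7, e_apply, conj_apply]
  simp [Fin.sum_univ_eight, crossMap_apply, e_apply, Octonion.mul_zero, Octonion.mul_sub, h2, h4]

theorem sum_conj_mul_neg_crossMap : ∑ i, conj (e i) ⊛ (-crossMap) (e i) = 0 := by
  have h : ∀ x y : Octonion, x ⊛ (-y) = -(x ⊛ y) := fun x y => (mulL x).map_neg y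
  simp [h, sum_conj_mul_crossMap]

theorem mul_outerOne (L : Octonion →L[ℝ] Octonion) (η : S7) :
    (η : Octonion) ⊛ outerOne L η = L η := by
  simp [outerOne, mul_conj_mul]

theorem integral_crossMap_pos : 0 < (areaS7.real Set.univ)⁻¹ *
    ∫ η : S7, ((η : Octonion) 2 ^ 2 + (η : Octonion) 4 ^ 2) ∂areaS7 := by
  have hpos : (areaS7.IsOpenPosMeasure) :=
    inferInstanceAs ((volume : Measure Octonion).toSphere.IsOpenPosMeasure)
  have hne : areaS7 ≠ 0 := (volume : Measure Octonion).toSphere_ne_zero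
  have : NeZero areaS7 := ⟨hne⟩
  refine mul_pos (inv_pos.2 measureReal_univ_pos) ?_
  refine Continuous.integral_pos_of_hasCompactSupport_nonneg_nonzero (by fun_prop)
    (.of_compactSpace _) (fun η => by positivity) (x := ⟨e 2, by simp [norm_e]⟩) ?_
  simp [e_apply]

theorem sphereInner_const_outerOne :
    inner ℝ (sphereInner (restrictS7 fun _ => e 1) (restrictS7 (outerOne crossMap))) (e 3)
      = (areaS7.real Set.univ)⁻¹ *
        ∫ η : S7, ((η : Octonion) 2 ^ 2 + (η : Octonion) 4 ^ 2) ∂areaS7 := by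
  have hP := (isInnerSpherical_zero_const (e 1)).isHomogAnalytic
  have hQ := (isOuterSpherical_one crossMap sum_conj_mul_crossMap).isHomogAnalytic
  rw [inner_sphereInner hP.memLp_restrictS7 hQ.memLp_restrictS7]
  congr 2
  ext η
  simp only [restrictS7, mul_outerOne]
  obtain ⟨h0, h1, h2, h3, h4, h5, h6, h7⟩ := mul_coords (η : Octonion) (e 1)
  obtain ⟨k0, k1, k2, k3, k4, k5, k6, k7⟩ := mul_coords (crossMap η) (e 3)
  simp only [PiLp.inner_apply, Fin.sum_univ_eight, h0, h1, h2, h3, h4, h5, h6, h7,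
    k0, k1, k2, k3, k4, k5, k6, k7]
  simp [crossMap_apply, e_apply]

theorem sphereInner_outerOne_const :
    inner ℝ (sphereInner (restrictS7 (outerOne (-crossMap))) (restrictS7 fun _ => e 1)) (e 3)
      = (areaS7.real Set.univ)⁻¹ *
        ∫ η : S7, ((η : Octonion) 2 ^ 2 + (η : Octonion) 4 ^ 2) ∂areaS7 := by
  have hP := (isInnerSpherical_zero_const (e 1)).isHomogAnalytic
  have hQ := (isOuterSpherical_one (-crossMap) sum_conj_mul_neg_crossMap).isHomogAnalytic
  rw [inner_sphereInner hQ.memLp_restrictS7 hP.memLp_restrictS7]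
  congr 2
  ext η
  simp only [restrictS7, mul_outerOne]
  obtain ⟨h0, h1, h2, h3, h4, h5, h6, h7⟩ := mul_coords (η : Octonion) (e 1)
  obtain ⟨k0, k1, k2, k3, k4, k5, k6, k7⟩ := mul_coords ((η : Octonion) ⊛ e 1) (e 3)
  simp only [PiLp.inner_apply, Fin.sum_univ_eight, h0, h1, h2, h3, h4, h5, h6, h7,
    k0, k1, k2, k3, k4, k5, k6, k7]
  simp [crossMap_apply, e_apply]

/-- Cross terms that do not cancel: `f = e₁ - Q` and `g = e₁ + Q` with `Q` outer of order `1`. -/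
theorem exists_cross_terms_ne_zero :
    ∃ f g : S7 → Octonion, MemLp f 2 areaS7 ∧ MemLp g 2 areaS7 ∧
      ∃ Pf Qf Pg Qg : ℕ → Octonion → Octonion,
        IsSphericalExpansion f Pf Qf ∧ IsSphericalExpansion g Pg Qg ∧
        (∃ k : ℕ,
          sphereInner (restrictS7 (Pf k)) (restrictS7 (Qg (k + 1))) ≠ 0 ∧
          sphereInner (restrictS7 (Qf (k + 1))) (restrictS7 (Pg k)) ≠ 0) ∧
        ∑' k : ℕ, (sphereInner (restrictS7 (Pf k)) (restrictS7 (Qg (k + 1))) +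
          sphereInner (restrictS7 (Qf (k + 1))) (restrictS7 (Pg k))) ≠ 0 := by
  have hP := isInnerSpherical_zero_const (e 1)
  have hQ : IsOuterSpherical 1 (outerOne crossMap) :=
    isOuterSpherical_one crossMap sum_conj_mul_crossMap
  have hQ' : IsOuterSpherical 1 (outerOne (-crossMap)) :=
    isOuterSpherical_one (-crossMap) sum_conj_mul_neg_crossMap
  have hpos := integral_crossMap_pos
  refine ⟨_, _, hP.isHomogAnalytic.memLp_restrictS7.add hQ'.isHomogAnalytic.memLp_restrictS7,
    hP.isHomogAnalytic.memLp_restrictS7.add hQ.isHomogAnalytic.memLp_restrictS7, _, _, _, _,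
    isSphericalExpansion_add hP hQ', isSphericalExpansion_add hP hQ, ⟨0, ?_, ?_⟩, ?_⟩
  · intro h
    have h' := sphereInner_const_outerOne
    simp only [if_true, zero_add] at h
    rw [h, inner_zero_left] at h'
    exact hpos.ne h'
  · intro h
    have h' := sphereInner_outerOne_const
    simp only [if_true, zero_add] at h
    rw [h, inner_zero_left] at h'
    exact hpos.ne h'
  · have hz : ∀ f : S7 → Octonion, sphereInner f (restrictS7 0) = 0 := fun f => by
      have h1 : restrictS7 0 = (0 : ℝ) • f := by
        ext η
        simp [restrictS7]
      rw [h1, sphereInner_smul_right, zero_smul]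
    rw [tsum_eq_single 0]
    · intro h
      have h' := congrArg (fun z => inner ℝ z (e 3)) h
      simp only [if_true, zero_add, inner_add_left, inner_zero_left, sphereInner_const_outerOne,
        sphereInner_outerOne_const] at h'
      linarith
    · intro k hk
      simp [hk, hz]

theorem proposition3p1 :
    (∀ f g : S7 → Octonion, MemLp f 2 areaS7 → MemLp g 2 areaS7 →
      ∀ Pf Qf Pg Qg : ℕ → Octonion → Octonion,
        IsSphericalExpansion f Pf Qf → IsSphericalExpansion g Pg Qg →
        Summable (fun k : ℕ =>
          sphereInner (restrictS7 (Pf k)) (restrictS7 (Pg k)) +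
            sphereInner (restrictS7 (Qf k)) (restrictS7 (Qg k))) ∧
        Summable (fun k : ℕ =>
          sphereInner (restrictS7 (Pf k)) (restrictS7 (Qg (k + 1))) +
            sphereInner (restrictS7 (Qf (k + 1))) (restrictS7 (Pg k))) ∧
        sphereInner f g =
          ∑' k : ℕ, (sphereInner (restrictS7 (Pf k)) (restrictS7 (Pg k)) +
            sphereInner (restrictS7 (Qf k)) (restrictS7 (Qg k))) +
          ∑' k : ℕ, (sphereInner (restrictS7 (Pf k)) (restrictS7 (Qg (k + 1))) +
            sphereInner (restrictS7 (Qf (k + 1))) (restrictS7 (Pg k)))) ∧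
    (∃ f g : S7 → Octonion, MemLp f 2 areaS7 ∧ MemLp g 2 areaS7 ∧
      ∃ Pf Qf Pg Qg : ℕ → Octonion → Octonion,
        IsSphericalExpansion f Pf Qf ∧ IsSphericalExpansion g Pg Qg ∧
        (∃ k : ℕ,
          sphereInner (restrictS7 (Pf k)) (restrictS7 (Qg (k + 1))) ≠ 0 ∧
          sphereInner (restrictS7 (Qf (k + 1))) (restrictS7 (Pg k)) ≠ 0) ∧
        ∑' k : ℕ, (sphereInner (restrictS7 (Pf k)) (restrictS7 (Qg (k + 1))) +
          sphereInner (restrictS7 (Qf (k + 1))) (restrictS7 (Pg k))) ≠ 0) := by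
  exact ⟨fun f g hf hg Pf Qf Pg Qg hF hG => sphereInner_expansion hf hg hF hG,
    exists_cross_terms_ne_zero⟩
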